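/- Conventions. A length function on a group $K$ is a map $l:K\to\mathbb N$ with $l(e)=0$, $l(x^{-1})=l(x)$ and $l(xy)\le l(x)+l(y)$. For $\varphi\in\mathbb C[K]$ let $\|\varphi\|$ be the operator norm of $\varphi$ acting on $\ell^2(K)$ by the left regular representation and $\|\varphi\|_2=(\sum_x|\varphi(x)|^2)^{1/2}$. For $f:\mathbb N\to\mathbb R$, the pair $(K,l)$ has $f$-decay if $\|\varphi\|\le f(n)\|\varphi\|_2$ for all $n\in\mathbb N$ and all $\varphi\in\mathbb C[K]$ supported on $\{x: l(x)\le n\}$. A function $f:\mathbb N\to\mathbb R_{\ge0}$ is subexponential if $f(n)^{1/n}\to1$. The pair $(K,l)$ has RD (resp. SD) if it has $f$-decay for some polynomial (resp. subexponential) $f$; $K$ has RD (resp. SD) if $(K,l)$ does for some length function $l$. Two length functions $l_1,l_2$ on $K$ are $g$-distorted if $l_1(x)\le g(l_2(x))$ and $l_2(x)\le g(l_1(x))$ for all $x\in K$; they are polynomially, subexponentially or linearly distorted if $g$ can be chosen polynomial, subexponential, or of the form $g(n)=Cn+D$. For $f:\mathbb N\to\mathbb R$ put $\tilde f(x)=(2x+1)^{7/2}f(2x)$.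 Theorem. Let $(G,L_G)$ and $(H,L_H)$ be groups with length functions and a common subgroup $A$. For $k\in G*_AH$ let $$L^U(k)=\min\Big\{\sum_i L_i(k_i)\ :\ \prod_i k_i=k,\ k_i\in G\cup H\Big\},$$ where $L_i=L_G$ if $k_i\in G\setminus A$, $L_i=L_H$ if $k_i\in H\setminus A$, and $L_i$ may be chosen to be either $L_G$ or $L_H$ if $k_i\in A$. Then $L^U$ is a length function on $G*_AH$. Moreover: (0) Suppose that $L_G\ge1$ on $G\setminus A$ and $L_H\ge1$ on $H\setminus A$. Let $f:\mathbb N\to\mathbb R$ and let $g:\mathbb N\to\mathbb N$ be non-decreasing. If $(G,L_G)$ and $(H,L_H)$ have $f$-decay and the pairs $(L^U|_G,L_G)$ on $G$ and $(L^U|_H,L_H)$ on $H$ are $g$-distorted, then $(G*_AH,L^U)$ has $\widetilde{f\circ g}$-decay, where $\widetilde{f\circ g}(x)=(2x+1)^{7/2}f(g(2x))$. If in addition $g(n)\ge n$ for all $n$, then $G*_AH$ has $\tilde f\circ g$-decay with respect to the length function $2L^U$, where $(\tilde f\circ g)(x)=(2g(x)+1)^{7/2}f(2g(x))$; and if moreover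 $g(2n)\le 2g(n)$ for all $n$, then $(G*_AH,L^U)$ has $\tilde f\circ g$-decay. (1) If $(G,L_G)$ and $(H,L_H)$ have RD and the pairs $(L^U|_G,L_G)$ and $(L^U|_H,L_H)$ are polynomially distorted, then $G*_AH$ has RD. (2) If $(G,L_G)$ and $(H,L_H)$ have RD and the pairs $(L^U|_G,L_G)$ and $(L^U|_H,L_H)$ are subexponentially distorted, then $G*_AH$ has SD. (3) If $(G,L_G)$ and $(H,L_H)$ have SD and the pairs $(L^U|_G,L_G)$ and $(L^U|_H,L_H)$ are linearly distorted, then $G*_AH$ has SD. In (1)-(3), if $L_G\ge1$ on $G\setminus A$ and $L_H\ge1$ on $H\setminus A$, then $(G*_AH,L^U)$ itself has RD (resp. SD). -/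

import Mathlib

universe u v

noncomputable section

namespace GroupDecay

/-! ### Length functions -/

/-- A length function on a group, with values in the natural numbers. -/
structure IsLength {G : Type*} [Group G] (l : G → ℕ) : Prop where
  map_one : l 1 = 0
  map_inv : ∀ x, l x⁻¹ = l x
  map_mul_le : ∀ x y, l (x * y) ≤ l x + l y

/-! ### The left regular representation and decay -/

/-- The Hilbert space `ℓ²(G)`. -/
abbrev L2 (G : Type*) : Type _ := lp (fun _ : G => ℂ) 2

theorem memlp_translate {G : Type*} [Group G] (g : G) (ξ : L2 G) :
    Memℓp (fun x : G => (ξ : G → ℂ) (g⁻¹ * x)) 2 := by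
  have h2 : 0 < (2 : ENNReal).toReal := by norm_num
  refine memℓp_gen ?_
  exact (Equiv.mulLeft g⁻¹).summable_iff.mpr ((memℓp_gen_iff h2).1 (lp.memℓp ξ))

/-- The unitary `λ(g)` of the left regular representation: `(λ(g) ξ)(x) = ξ(g⁻¹ x)`. -/
def translate {G : Type*} [Group G] (g : G) : L2 G →ₗᵢ[ℂ] L2 G where
  toFun ξ := ⟨fun x => (ξ : G → ℂ) (g⁻¹ * x), memlp_translate g ξ⟩
  map_add' _ _ := rfl
  map_smul' _ _ := rfl
  norm_map' ξ := by
    have h2 : 0 < (2 : ENNReal).toReal := by norm_num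
    rw [lp.norm_eq_tsum_rpow h2, lp.norm_eq_tsum_rpow h2]
    congr 1
    exact (Equiv.mulLeft g⁻¹).tsum_eq (fun x => ‖(ξ : G → ℂ) x‖ ^ (2 : ENNReal).toReal)

/-- The operator on `ℓ²(G)` by which an element of `ℂ[G]` acts in the left regular
representation, `λ(φ) = ∑ φ(g) λ(g)`. -/
def regularRep {G : Type*} [Group G] (φ : MonoidAlgebra ℂ G) : L2 G →L[ℂ] L2 G :=
  ∑ g ∈ φ.coeff.support, φ.coeff g • (translate g).toContinuousLinearMap

/-- The norm `‖φ‖₂ = (∑ |φ(g)|²)^{1/2}` of an element of `ℂ[G]`. -/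
def twoNorm {G : Type*} (φ : MonoidAlgebra ℂ G) : ℝ :=
  Real.sqrt (∑ g ∈ φ.coeff.support, ‖φ.coeff g‖ ^ 2)

/-- `(G, l)` has `f`-decay: `‖λ(φ)‖ ≤ f(n) ‖φ‖₂` for every `φ ∈ ℂ[G]` supported on the closed
`l`-ball of radius `n` around the identity. -/
def HasDecay {G : Type*} [Group G] (l : G → ℕ) (f : ℕ → ℝ) : Prop :=
  ∀ (n : ℕ) (φ : MonoidAlgebra ℂ G), (∀ g ∈ φ.coeff.support, l g ≤ n) →
    ‖regularRep φ‖ ≤ f n * twoNorm φ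

/-- A function `f : ℕ → ℝ≥0` is subexponential if `f(n)^{1/n} → 1`. -/
def Subexponential (f : ℕ → ℝ) : Prop :=
  (∀ n, 0 ≤ f n) ∧
    Filter.Tendsto (fun n : ℕ => f n ^ (1 / (n : ℝ))) Filter.atTop (nhds 1)

/-- Rapid decay with respect to a given length function. -/
def HasRDWith {G : Type*} [Group G] (l : G → ℕ) : Prop :=
  ∃ P : Polynomial ℝ, HasDecay l (fun n => P.eval (n : ℝ))

/-- Subexponential decay with respect to a given length function. -/
def HasSDWith {G : Type*} [Group G] (l : G → ℕ) : Prop :=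
  ∃ f : ℕ → ℝ, Subexponential f ∧ HasDecay l f

/-- Property RD of a group. -/
def HasRD (G : Type*) [Group G] : Prop := ∃ l : G → ℕ, IsLength l ∧ HasRDWith l

/-- Property SD of a group. -/
def HasSD (G : Type*) [Group G] : Prop := ∃ l : G → ℕ, IsLength l ∧ HasSDWith l

/-! ### Distortion -/

/-- The pair `(l₁, l₂)` is `g`-distorted. -/
def Distorted {G : Type*} (g : ℕ → ℝ) (l₁ l₂ : G → ℕ) : Prop :=
  ∀ x, (l₁ x : ℝ) ≤ g (l₂ x) ∧ (l₂ x : ℝ) ≤ g (l₁ x)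

def PolynomiallyDistorted {G : Type*} (l₁ l₂ : G → ℕ) : Prop :=
  ∃ P : Polynomial ℝ, Distorted (fun n => P.eval (n : ℝ)) l₁ l₂

def SubexponentiallyDistorted {G : Type*} (l₁ l₂ : G → ℕ) : Prop :=
  ∃ g : ℕ → ℝ, Subexponential g ∧ Distorted g l₁ l₂

def LinearlyDistorted {G : Type*} (l₁ l₂ : G → ℕ) : Prop :=
  ∃ C D : ℝ, Distorted (fun n => C * (n : ℝ) + D) l₁ l₂

/-- The operation `f ↦ f̃`, where `f̃(x) = (2x+1)^{7/2} f(2x)`. -/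
def tilde (f : ℕ → ℝ) : ℕ → ℝ :=
  fun x => (2 * (x : ℝ) + 1) ^ (7 / 2 : ℝ) * f (2 * x)

/-! ### Amalgamated free products of two groups -/

/-- The two-element family consisting of `G` and `H`. -/
def Pair (G H : Type u) : Bool → Type u
  | false => G
  | true => H

instance instGroupPair (G H : Type u) [Group G] [Group H] : ∀ b, Group (Pair G H b)
  | false => inferInstanceAs (Group G)
  | true => inferInstanceAs (Group H)

section Amalgam

variable {G H : Type u} {A : Type v} [Group G] [Group H] [Group A]

/-- The two inclusions of the common subgroup `A`. -/
def pairHom (i : A →* G) (j : A →* H) : ∀ b, A →* Pair G H b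
  | false => i
  | true => j

/-- The amalgamated free product `G *_A H`. -/
abbrev Amalgam (i : A →* G) (j : A →* H) : Type _ := Monoid.PushoutI (pairHom i j)

/-- The canonical map `G → G *_A H`. -/
def Amalgam.inl (i : A →* G) (j : A →* H) : G →* Amalgam i j :=
  Monoid.PushoutI.of (φ := pairHom i j) false

/-- The canonical map `H → G *_A H`. -/
def Amalgam.inr (i : A →* G) (j : A →* H) : H →* Amalgam i j :=
  Monoid.PushoutI.of (φ := pairHom i j) true

/-- The universal length `L^U` on `G *_A H`: the minimum of `∑ Lᵢ(kᵢ)` over all factorizations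
`k = ∏ kᵢ` with `kᵢ ∈ G ∪ H`. A factorization is a list of letters, each marked as an element of
`G` (and measured by `LG`) or of `H` (and measured by `LH`), so that a letter from `A` may be
measured by either of the two lengths. -/
def universalLength (i : A →* G) (j : A →* H) (LG : G → ℕ) (LH : H → ℕ) (k : Amalgam i j) : ℕ :=
  sInf {n | ∃ w : List (G ⊕ H),
    (w.map (Sum.elim (Amalgam.inl i j) (Amalgam.inr i j))).prod = k ∧
    (w.map (Sum.elim LG LH)).sum = n}

/-- The restriction `L^U|_G`. -/
def universalLengthLeft (i : A →* G) (j : A →* H) (LG : G → ℕ) (LH : H → ℕ) (x : G) : ℕ :=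
  universalLength i j LG LH (Amalgam.inl i j x)

/-- The restriction `L^U|_H`. -/
def universalLengthRight (i : A →* G) (j : A →* H) (LG : G → ℕ) (LH : H → ℕ) (y : H) : ℕ :=
  universalLength i j LG LH (Amalgam.inr i j y)

/-- Every element of `G` outside `A` and every element of `H` outside `A` has length at least
`1`. -/
def PositiveOffAmalgam (i : A →* G) (j : A →* H) (LG : G → ℕ) (LH : H → ℕ) : Prop :=
  (∀ x : G, x ∉ i.range → 1 ≤ LG x) ∧ (∀ y : H, y ∉ j.range → 1 ≤ LH y)

end Amalgam

end GroupDecay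

end

open GroupDecay

/-! Decay is equivalent to the trilinear estimate `∑ φ(a) ψ(b) χ(ab) ≤ C ‖φ‖₂ ‖ψ‖₂ ‖χ‖₂` for
non-negative functions with `φ` supported in a ball (`TrilinearBound.norm_regularRep_le`,
`trilinearBound_of_norm_regularRep_le`). In this form the sum can be cut into pieces according to
geometry.

The amalgam acts on its Bass–Serre tree with base vertex `o = G`. A pair `(x, y)` determines the
median `v` of `o`, `xo`, `xyo`, which is a coset of `G` or of `H`. Fix `l = d(o, v)` and `s = d(v,
xo)`. Then `x` alone determines `v`, so does `xy`, and `y` alone determines `x⁻¹v`. With coset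
representatives `r` one writes `x = r(w) a r(w')⁻¹`, `y = r(w') b r(w'')⁻¹`, `xy = r(w) ab
r(w'')⁻¹`, where `a, b` lie in a factor. The factor's estimate bounds the sum over `a, b`, and
Cauchy–Schwarz sums over `w, w', w''` without loss (`tsum_coset_trilinear_le`,
`tsum_coset_selection_le`).

Two bounds finish the argument. If `L^U(x) ≤ n`, a minimal word for `x` passes through `v`, so with
shortest representatives `L^U(a) ≤ 2n` (`tsum_onGeodesic_le`); the distortion turns this into a
bound on `L_G(a)` or `L_H(a)`. Moreover `d(o, xo) ≤ 2n` when lengths are at least `1` off `A`, so at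
most `(2n+1)²` pairs `(l, s)` occur (`trilinearBound_amalgam`). If lengths may vanish off `A`, they
are first raised by `1` there, which only shrinks balls. -/

open GroupDecay

open scoped ENNReal NNReal

namespace GroupDecay

/-! ### Square sums with values in `[0, ∞]` -/

/-- The `ℓ²` norm of a function with values in `[0, ∞]`. -/
noncomputable def enormTwo {X : Type*} (φ : X → ℝ≥0∞) : ℝ≥0∞ := (∑' x, φ x ^ 2) ^ (1 / 2 : ℝ)

theorem enormTwo_sq {X : Type*} (φ : X → ℝ≥0∞) : enormTwo φ ^ 2 = ∑' x, φ x ^ 2 := by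
  rw [enormTwo, ← ENNReal.rpow_natCast, ← ENNReal.rpow_mul]
  norm_num

theorem enormTwo_le_of_sq_le {X : Type*} {φ : X → ℝ≥0∞} {c : ℝ≥0∞} (h : ∑' x, φ x ^ 2 ≤ c ^ 2) :
    enormTwo φ ≤ c := by
  rw [← enormTwo_sq] at h
  exact (ENNReal.pow_le_pow_left_iff two_ne_zero).1 h

theorem tsum_mul_le_enormTwo {X : Type*} (φ ψ : X → ℝ≥0∞) :
    ∑' x, φ x * ψ x ≤ enormTwo φ * enormTwo ψ := by
  rw [ENNReal.tsum_eq_iSup_sum]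
  refine iSup_le fun s => ?_
  refine (ENNReal.inner_le_Lp_mul_Lq s φ ψ Real.HolderConjugate.two_two).trans ?_
  unfold enormTwo
  gcongr
  · simpa using ENNReal.sum_le_tsum (f := fun x => φ x ^ 2) s
  · simpa using ENNReal.sum_le_tsum (f := fun x => ψ x ^ 2) s

/-- Submultiplicativity of the Hilbert–Schmidt norm, in dual form: Cauchy–Schwarz in `z`, then in
`(x, y)`. -/
theorem tsum_trilinear_le_enormTwo {X Y Z : Type*} (α : X → Y → ℝ≥0∞) (β : Y → Z → ℝ≥0∞)
    (γ : X → Z → ℝ≥0∞) :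
    ∑' x, ∑' y, ∑' z, α x y * β y z * γ x z ≤
      enormTwo (fun p : X × Y => α p.1 p.2) * enormTwo (fun p : Y × Z => β p.1 p.2) *
        enormTwo (fun p : X × Z => γ p.1 p.2) := by
  have h1 : ∀ x y, ∑' z, α x y * β y z * γ x z ≤ α x y * (enormTwo (β y) * enormTwo (γ x)) := by
    intro x y
    simp_rw [mul_assoc]
    rw [ENNReal.tsum_mul_left]
    gcongr
    exact tsum_mul_le_enormTwo _ _
  calc ∑' x, ∑' y, ∑' z, α x y * β y z * γ x z
      ≤ ∑' x, ∑' y, α x y * (enormTwo (β y) * enormTwo (γ x)) := by gcongr; exact h1 _ _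
    _ = ∑' p : X × Y, α p.1 p.2 * (enormTwo (β p.2) * enormTwo (γ p.1)) := by
        rw [ENNReal.tsum_prod']
    _ ≤ enormTwo (fun p : X × Y => α p.1 p.2) *
          enormTwo (fun p : X × Y => enormTwo (β p.2) * enormTwo (γ p.1)) :=
        tsum_mul_le_enormTwo _ _
    _ ≤ _ := by
        rw [mul_assoc]
        gcongr
        apply enormTwo_le_of_sq_le
        rw [mul_pow, enormTwo_sq, enormTwo_sq, ENNReal.tsum_prod', ENNReal.tsum_prod',
          ENNReal.tsum_prod']
        simp_rw [mul_pow, enormTwo_sq]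
        simp_rw [ENNReal.tsum_mul_right]
        rw [ENNReal.tsum_mul_left]

/-! ### Decay as a trilinear estimate -/

/-- The estimate `∑ φ(a) ψ(b) χ(ab) ≤ C ‖φ‖₂ ‖ψ‖₂ ‖χ‖₂` for non-negative functions on a group,
the first of which is supported in `B`. -/
def TrilinearBound {M : Type*} [Group M] (B : Set M) (C : ℝ≥0∞) : Prop :=
  ∀ φ ψ χ : M → ℝ≥0, (∀ a, φ a ≠ 0 → a ∈ B) →
    ∑' a, ∑' b, (φ a * ψ b * χ (a * b) : ℝ≥0∞) ≤
      C * (enormTwo (fun x => (φ x : ℝ≥0∞)) * enormTwo (fun x => (ψ x : ℝ≥0∞)) *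
        enormTwo (fun x => (χ x : ℝ≥0∞)))

theorem regularRep_apply {M : Type*} [Group M] (φ : MonoidAlgebra ℂ M) (ξ : L2 M) (x : M) :
    (regularRep φ ξ : M → ℂ) x =
      ∑ g ∈ φ.coeff.support, φ.coeff g * (ξ : M → ℂ) (g⁻¹ * x) := by
  unfold regularRep
  rw [_root_.sum_apply, lp.coeFn_sum, Finset.sum_apply]
  rfl

theorem enormTwo_lp {M : Type*} (ξ : L2 M) :
    enormTwo (fun x => ‖(ξ : M → ℂ) x‖ₑ) = ‖ξ‖ₑ := by
  have h2 : 0 < (2 : ENNReal).toReal := by norm_num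
  have hs : HasSum (fun x => ‖(ξ : M → ℂ) x‖ ^ 2) (‖ξ‖ ^ 2) := by
    simpa using lp.hasSum_norm h2 ξ
  have h : ∑' x, ‖(ξ : M → ℂ) x‖ₑ ^ 2 = ‖ξ‖ₑ ^ 2 := by
    have h3 : ∀ x, ‖(ξ : M → ℂ) x‖ₑ ^ 2 = ENNReal.ofReal (‖(ξ : M → ℂ) x‖ ^ 2) := by
      intro x
      rw [← ofReal_norm, ENNReal.ofReal_pow (norm_nonneg _)]
    simp_rw [h3]
    rw [← ENNReal.ofReal_tsum_of_nonneg (fun _ => by positivity) hs.summable, hs.tsum_eq,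
      ← ofReal_norm, ENNReal.ofReal_pow (norm_nonneg _)]
  rw [← enormTwo_sq] at h
  exact le_antisymm ((ENNReal.pow_le_pow_left_iff two_ne_zero).1 h.le)
    ((ENNReal.pow_le_pow_left_iff two_ne_zero).1 h.ge)

theorem enormTwo_coeff {M : Type*} (φ : MonoidAlgebra ℂ M) :
    enormTwo (fun x => ‖φ.coeff x‖ₑ) = ENNReal.ofReal (twoNorm φ) := by
  have h : enormTwo (fun x => ‖φ.coeff x‖ₑ) ^ 2 = ENNReal.ofReal (twoNorm φ) ^ 2 := by
    rw [enormTwo_sq, twoNorm, ← ENNReal.ofReal_pow (Real.sqrt_nonneg _),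
      Real.sq_sqrt (by positivity), ENNReal.ofReal_sum_of_nonneg (fun _ _ => by positivity),
      tsum_eq_sum (s := φ.coeff.support)]
    · refine Finset.sum_congr rfl fun x _ => ?_
      rw [← ofReal_norm, ENNReal.ofReal_pow (norm_nonneg _)]
    · intro x hx
      simp [Finsupp.notMem_support_iff.1 hx]
  exact le_antisymm ((ENNReal.pow_le_pow_left_iff two_ne_zero).1 h.le)
    ((ENNReal.pow_le_pow_left_iff two_ne_zero).1 h.ge)

/-- A trilinear estimate bounds the operator norm in the regular representation. -/
theorem TrilinearBound.norm_regularRep_le {M : Type*} [Group M] {B : Set M} {C : ℝ}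
    (hC : 0 ≤ C) (h : TrilinearBound B (ENNReal.ofReal C)) (φ : MonoidAlgebra ℂ M)
    (hφ : ∀ x ∈ φ.coeff.support, x ∈ B) : ‖regularRep φ‖ ≤ C * twoNorm φ := by
  have h0 : 0 ≤ twoNorm φ := Real.sqrt_nonneg _
  refine ContinuousLinearMap.opNorm_le_bound _ (by positivity) fun ξ => ?_
  set η := regularRep φ ξ with hη
  have key := h (fun x => ‖φ.coeff x‖₊) (fun x => ‖(ξ : M → ℂ) x‖₊) (fun x => ‖(η : M → ℂ) x‖₊)
    (fun a ha => hφ a (by simpa using ha))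
  have e1 : enormTwo (fun x => ((‖φ.coeff x‖₊ : ℝ≥0) : ℝ≥0∞)) = ENNReal.ofReal (twoNorm φ) :=
    enormTwo_coeff φ
  have e2 : enormTwo (fun x => ((‖(ξ : M → ℂ) x‖₊ : ℝ≥0) : ℝ≥0∞)) = ENNReal.ofReal ‖ξ‖ := by
    rw [ofReal_norm]; exact enormTwo_lp ξ
  have e3 : enormTwo (fun x => ((‖(η : M → ℂ) x‖₊ : ℝ≥0) : ℝ≥0∞)) = ENNReal.ofReal ‖η‖ := by
    rw [ofReal_norm]; exact enormTwo_lp η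
  rw [e1, e2, e3] at key
  -- Here `χ = |η|` is the test function: after substituting `b = a⁻¹x`, the triangle inequality
  -- makes the sum over `a` at least `|η(x)|`, which produces `‖η‖²`.
  have low : ENNReal.ofReal (‖η‖ ^ 2) ≤ ∑' a, ∑' b, ((‖φ.coeff a‖₊ : ℝ≥0) *
      (‖(ξ : M → ℂ) b‖₊ : ℝ≥0) * (‖(η : M → ℂ) (a * b)‖₊ : ℝ≥0) : ℝ≥0∞) := by
    rw [ENNReal.ofReal_pow (norm_nonneg _), ← e3, enormTwo_sq]
    have s1 : ∀ a, ∑' b, ((‖φ.coeff a‖₊ : ℝ≥0) *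
      (‖(ξ : M → ℂ) b‖₊ : ℝ≥0) * (‖(η : M → ℂ) (a * b)‖₊ : ℝ≥0) : ℝ≥0∞) =
      ∑' x, ((‖φ.coeff a‖₊ : ℝ≥0) *
      (‖(ξ : M → ℂ) (a⁻¹ * x)‖₊ : ℝ≥0) * (‖(η : M → ℂ) x‖₊ : ℝ≥0) : ℝ≥0∞) := by
      intro a
      rw [← (Equiv.mulLeft a⁻¹).tsum_eq]
      simp
    simp_rw [s1]
    rw [ENNReal.tsum_comm]
    refine ENNReal.tsum_le_tsum fun x => ?_
    rw [ENNReal.tsum_mul_right, sq]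
    gcongr
    refine le_trans ?_ (ENNReal.sum_le_tsum φ.coeff.support)
    have : (η : M → ℂ) x = _ := regularRep_apply φ ξ x
    rw [this]
    norm_cast
    refine (nnnorm_sum_le _ _).trans (Finset.sum_le_sum fun a _ => ?_)
    rw [nnnorm_mul]
  have fin : ‖η‖ ^ 2 ≤ C * (twoNorm φ * ‖ξ‖ * ‖η‖) := by
    rw [← ENNReal.ofReal_mul (by positivity), ← ENNReal.ofReal_mul (by positivity),
      ← ENNReal.ofReal_mul (by positivity)] at key
    exact (ENNReal.ofReal_le_ofReal_iff (by positivity)).1 (low.trans key)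
  rcases (norm_nonneg η).eq_or_lt with h3 | h3
  · rw [← h3]; positivity
  · refine le_of_mul_le_mul_right ?_ h3
    calc ‖η‖ * ‖η‖ = ‖η‖ ^ 2 := (sq _).symm
      _ ≤ _ := fin
      _ = _ := by ring

/-- A bound for the operator norm in the regular representation gives a trilinear estimate. -/
theorem trilinearBound_of_norm_regularRep_le {M : Type*} [Group M] {B : Set M} {C : ℝ}
    (hC : 0 ≤ C) (h : ∀ φ : MonoidAlgebra ℂ M, (∀ x ∈ φ.coeff.support, x ∈ B) →
      ‖regularRep φ‖ ≤ C * twoNorm φ) : TrilinearBound B (ENNReal.ofReal C) := by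
  classical
  intro φ ψ χ hφ
  rw [ENNReal.tsum_eq_iSup_sum]
  refine iSup_le fun S => ?_
  simp_rw [← Summable.tsum_finsetSum (fun _ _ => ENNReal.summable)]
  rw [ENNReal.tsum_eq_iSup_sum]
  refine iSup_le fun R => ?_
  rw [Finset.sum_comm]
  -- Only the values of `χ` on products from `S` and `R` matter, so all three functions can be
  -- truncated to finite supports.
  set U : Finset M := Finset.image₂ (· * ·) S R with hU
  have restrict : ∀ (f : M → ℝ≥0) (s : Finset M),
      ENNReal.ofReal (Real.sqrt (∑ x ∈ s, (f x : ℝ) ^ 2)) ≤ enormTwo (fun x => (f x : ℝ≥0∞)) := by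
    intro f s
    rw [← ENNReal.pow_le_pow_left_iff two_ne_zero, ← ENNReal.ofReal_pow (Real.sqrt_nonneg _),
      Real.sq_sqrt (by positivity), enormTwo_sq,
      ENNReal.ofReal_sum_of_nonneg (fun _ _ => by positivity)]
    refine le_trans (le_of_eq ?_) (ENNReal.sum_le_tsum s)
    refine Finset.sum_congr rfl fun x _ => ?_
    rw [ENNReal.ofReal_pow (by positivity), ENNReal.ofReal_coe_nnreal]
  have real : ∑ a ∈ S, ∑ b ∈ R, (φ a * ψ b * χ (a * b) : ℝ) ≤
      C * (Real.sqrt (∑ x ∈ S, (φ x : ℝ) ^ 2) * Real.sqrt (∑ x ∈ R, (ψ x : ℝ) ^ 2) *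
        Real.sqrt (∑ x ∈ U, (χ x : ℝ) ^ 2)) := by
    let Φ : MonoidAlgebra ℂ M :=
      MonoidAlgebra.ofCoeff (Finsupp.indicator S fun a _ => ((φ a : ℝ) : ℂ))
    have Φ_apply : ∀ a, Φ.coeff a = if a ∈ S then ((φ a : ℝ) : ℂ) else 0 := by
      intro a
      simp [Φ, Finsupp.indicator_apply]
    have Φ_supp : Φ.coeff.support ⊆ S := by
      intro a ha
      by_contra hn
      simp [Φ_apply, hn] at ha
    have Φ_norm : twoNorm Φ = Real.sqrt (∑ x ∈ S, (φ x : ℝ) ^ 2) := by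
      rw [twoNorm]
      congr 1
      rw [Finset.sum_subset Φ_supp]
      · refine Finset.sum_congr rfl fun x hx => ?_
        simp [Φ_apply, hx]
      · intro x _ hx
        simp [Finsupp.notMem_support_iff.1 hx]
    have vec : ∀ (f : M → ℝ≥0) (s : Finset M), ∃ ξ : L2 M,
        (∀ x, (ξ : M → ℂ) x = if x ∈ s then ((f x : ℝ) : ℂ) else 0) ∧
        ‖ξ‖ = Real.sqrt (∑ x ∈ s, (f x : ℝ) ^ 2) := by
      intro f s
      refine ⟨∑ x ∈ s, lp.single 2 x ((f x : ℝ) : ℂ), fun x => ?_, ?_⟩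
      · rw [lp.coeFn_sum, Finset.sum_apply]
        simp [Pi.single_apply]
      · have := lp.norm_sum_single (E := fun _ : M => ℂ) (p := 2) (by norm_num)
          (fun x => ((f x : ℝ) : ℂ)) s
        rw [eq_comm, Real.sqrt_eq_iff_mul_self_eq (by positivity) (norm_nonneg _), ← sq]
        simpa using this.symm
    obtain ⟨ξ, hξ, nξ⟩ := vec ψ R
    obtain ⟨η, hη, nη⟩ := vec χ U
    -- The truncated sum is a matrix coefficient of the operator, hence controlled by its norm.
    have inner_eq : inner ℂ η (regularRep Φ ξ) =
        ((∑ a ∈ S, ∑ b ∈ R, (φ a * ψ b * χ (a * b) : ℝ) : ℝ) : ℂ) := by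
      rw [lp.inner_eq_tsum, tsum_eq_sum (s := U)]
      · have : ∀ x ∈ U, inner ℂ ((η : M → ℂ) x) ((regularRep Φ ξ : M → ℂ) x) =
            ∑ a ∈ S, (φ a : ℂ) * (if a⁻¹ * x ∈ R then (ψ (a⁻¹ * x) : ℂ) else 0) * χ x := by
          intro x hx
          rw [regularRep_apply, Finset.sum_subset Φ_supp]
          · simp only [RCLike.inner_apply, hη, hx, if_true, hξ, Φ_apply]
            rw [Finset.sum_mul]
            refine Finset.sum_congr rfl fun a ha => ?_
            simp [ha]
          · intro a _ ha
            simp [Finsupp.notMem_support_iff.1 ha]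
        rw [Finset.sum_congr rfl this, Finset.sum_comm]
        push_cast
        refine Finset.sum_congr rfl fun a ha => ?_
        symm
        refine Finset.sum_of_injOn (fun b => a * b) (mul_right_injective a).injOn ?_ ?_ ?_
        · intro b hb
          exact Finset.mem_image₂_of_mem ha hb
        · intro x _ hx
          have : a⁻¹ * x ∉ R := fun hR => hx ⟨a⁻¹ * x, hR, by simp⟩
          simp [this]
        · intro b hb
          simp [hb]
      · intro x hx
        simp [hη, hx]
    have le : ‖inner ℂ η (regularRep Φ ξ)‖ ≤ ‖η‖ * (‖regularRep Φ‖ * ‖ξ‖) :=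
      (norm_inner_le_norm _ _).trans (by gcongr; exact ContinuousLinearMap.le_opNorm _ _)
    rw [inner_eq, Complex.norm_real] at le
    have hΦ := h Φ fun a ha => hφ a fun h0 => by simp [Φ_apply, h0] at ha
    rw [Φ_norm] at hΦ
    calc _ ≤ _ := le_abs_self _
      _ ≤ _ := le
      _ ≤ ‖η‖ * ((C * Real.sqrt (∑ x ∈ S, (φ x : ℝ) ^ 2)) * ‖ξ‖) := by gcongr
      _ = _ := by rw [nξ, nη]; ring
  calc ∑ a ∈ S, ∑ b ∈ R, (φ a * ψ b * χ (a * b) : ℝ≥0∞)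
      = ENNReal.ofReal (∑ a ∈ S, ∑ b ∈ R, (φ a * ψ b * χ (a * b) : ℝ)) := by
        simp_rw [← NNReal.coe_mul, ← NNReal.coe_sum, ENNReal.ofReal_coe_nnreal]
        push_cast
        rfl
    _ ≤ _ := ENNReal.ofReal_le_ofReal real
    _ ≤ _ := by
        rw [ENNReal.ofReal_mul hC, ENNReal.ofReal_mul (by positivity),
          ENNReal.ofReal_mul (by positivity)]
        gcongr <;> exact restrict _ _

/-! ### Trilinear estimates and cosets -/

section Cosets

variable {K M : Type*} [Group K] [Group M] {ι : M →* K}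

/-- If `x = k ι(a) r(w)⁻¹`, then `x⁻¹k = r(w) ι(a)⁻¹`: the coset of `x⁻¹k` gives `w`, and then `a`
is determined. -/
theorem bijective_coset_param (hι : Function.Injective ι) {r : K ⧸ ι.range → K}
    (hr : ∀ w, (r w : K ⧸ ι.range) = w) (k : K) :
    Function.Bijective (fun p : (K ⧸ ι.range) × M => k * ι p.2 * (r p.1)⁻¹) := by
  constructor
  · rintro ⟨w, a⟩ ⟨w', b⟩ h
    simp only at h
    have h1 : (r w)⁻¹ * r w' = ι (a⁻¹ * b) := by
      rw [map_mul, map_inv]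
      calc (r w)⁻¹ * r w' = (k * ι a)⁻¹ * (k * ι a * (r w)⁻¹) * r w' := by group
        _ = (k * ι a)⁻¹ * (k * ι b * (r w')⁻¹) * r w' := by rw [h]
        _ = _ := by group
    have h2 : w = w' := by
      rw [← hr w, ← hr w', QuotientGroup.eq, h1]
      exact ⟨_, rfl⟩
    subst h2
    have : ι a = ι b := by simpa using h
    rw [hι this]
  · intro x
    have h1 : (r ((x⁻¹ * k : K) : K ⧸ ι.range) : K ⧸ ι.range) = ((x⁻¹ * k : K) : K ⧸ ι.range) :=
      hr _
    rw [QuotientGroup.eq] at h1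
    obtain ⟨m, hm⟩ := h1
    refine ⟨(((x⁻¹ * k : K) : K ⧸ ι.range), m⁻¹), ?_⟩
    simp only [map_inv, hm]
    group

theorem tsum_coset_param (hι : Function.Injective ι) {r : K ⧸ ι.range → K}
    (hr : ∀ w, (r w : K ⧸ ι.range) = w) (k : K) (F : K → ℝ≥0∞) :
    ∑' x, F x = ∑' w, ∑' a, F (k * ι a * (r w)⁻¹) := by
  rw [← (Equiv.ofBijective _ (bijective_coset_param hι hr k)).tsum_eq, ENNReal.tsum_prod']
  rfl

/-- A trilinear estimate on a subgroup gives one for families of functions indexed by the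
cosets. -/
theorem tsum_coset_trilinear_le (hι : Function.Injective ι) {r : K ⧸ ι.range → K}
    (hr : ∀ w, (r w : K ⧸ ι.range) = w) {B : Set M} {C : ℝ≥0∞} (hB : TrilinearBound B C)
    (Φ Ψ X : K ⧸ ι.range → K → ℝ≥0)
    (hΦ : ∀ w w' a, Φ w (r w * ι a * (r w')⁻¹) ≠ 0 → a ∈ B) :
    ∑' w, ∑' x, ∑' y, (Φ w x * Ψ (x⁻¹ • w) y * X w (x * y) : ℝ≥0∞) ≤
      C * (enormTwo (fun p : (K ⧸ ι.range) × K => (Φ p.1 p.2 : ℝ≥0∞)) *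
        enormTwo (fun p : (K ⧸ ι.range) × K => (Ψ p.1 p.2 : ℝ≥0∞)) *
        enormTwo (fun p : (K ⧸ ι.range) × K => (X p.1 p.2 : ℝ≥0∞))) := by
  have coset : ∀ w w' a, (r w * ι a * (r w')⁻¹)⁻¹ • w = w' := by
    intro w w' a
    have h : ∀ k : K, k • w = ((k * r w : K) : K ⧸ ι.range) := fun k => by
      conv_lhs => rw [← hr w]
      rfl
    rw [h]
    conv_rhs => rw [← hr w']
    rw [QuotientGroup.eq]
    exact ⟨a, by group⟩
  -- Cosets act as matrix indices: `N F w w'` is the norm of the block of `F w` on elements carrying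
  -- `w'` to `w`.
  let N (F : K ⧸ ι.range → K → ℝ≥0) (w w' : K ⧸ ι.range) : ℝ≥0∞ :=
    enormTwo (fun a => (F w (r w * ι a * (r w')⁻¹) : ℝ≥0∞))
  have hN : ∀ F, enormTwo (fun p : (K ⧸ ι.range) × (K ⧸ ι.range) => N F p.1 p.2) =
      enormTwo (fun p : (K ⧸ ι.range) × K => (F p.1 p.2 : ℝ≥0∞)) := by
    intro F
    unfold enormTwo
    rw [ENNReal.tsum_prod', ENNReal.tsum_prod']
    congr 2
    funext w
    rw [tsum_coset_param hι hr (r w)]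
    simp only [N, enormTwo_sq]
  rw [← hN Φ, ← hN Ψ, ← hN X]
  -- The elements `x`, `y`, `xy` lie in the blocks `(w, w')`, `(w', w'')`, `(w, w'')` with middle
  -- entries `a`, `b`, `ab`. Each triple of blocks is an instance of `hB`, and the block norms are
  -- then multiplied as matrices.
  calc ∑' w, ∑' x, ∑' y, (Φ w x * Ψ (x⁻¹ • w) y * X w (x * y) : ℝ≥0∞)
      = ∑' w, ∑' w', ∑' w'', ∑' a, ∑' b, (Φ w (r w * ι a * (r w')⁻¹) *
          Ψ w' (r w' * ι b * (r w'')⁻¹) * X w (r w * ι (a * b) * (r w'')⁻¹) : ℝ≥0∞) := by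
        congr 1
        funext w
        rw [tsum_coset_param hι hr (r w)]
        congr 1
        funext w'
        conv_rhs => rw [ENNReal.tsum_comm]
        congr 1
        funext a
        rw [coset, tsum_coset_param hι hr (r w')]
        congr 1
        funext w''
        congr 1
        funext b
        congr 3
        rw [map_mul]
        group
    _ ≤ ∑' w, ∑' w', ∑' w'', C * (N Φ w w' * N Ψ w' w'' * N X w w'') := by
        gcongr with w w' w''
        exact hB (fun a => Φ w (r w * ι a * (r w')⁻¹)) (fun b => Ψ w' (r w' * ι b * (r w'')⁻¹))
          (fun c => X w (r w * ι c * (r w'')⁻¹)) (hΦ w w')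
    _ = C * ∑' w, ∑' w', ∑' w'', N Φ w w' * N Ψ w' w'' * N X w w'' := by
        simp_rw [ENNReal.tsum_mul_left]
    _ ≤ _ := by
        gcongr
        exact tsum_trilinear_le_enormTwo _ _ _

-- Each `x` is counted for at most one index, so spreading `φ` over the indices does not increase
-- its norm.
open Classical in
theorem enormTwo_indicator_le {X Y : Type*} {P : X → Y → Prop}
    (hP : ∀ x w w', P x w → P x w' → w = w') (φ : X → ℝ≥0) :
    enormTwo (fun p : Y × X => ((if P p.2 p.1 then φ p.2 else 0 : ℝ≥0) : ℝ≥0∞)) ≤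
      enormTwo (fun x => (φ x : ℝ≥0∞)) := by
  apply enormTwo_le_of_sq_le
  rw [enormTwo_sq, ENNReal.tsum_prod', ENNReal.tsum_comm]
  refine ENNReal.tsum_le_tsum fun x => ?_
  by_cases h : ∃ w, P x w
  · obtain ⟨w, hw⟩ := h
    rw [tsum_eq_single w]
    · simp [hw]
    · intro w' hw'
      have : ¬ P x w' := fun h' => hw' (hP x w' w h' hw)
      simp [this]
  · push Not at h
    simp [h]

open Classical in
/-- The contribution to a trilinear sum of the pairs `(x, y)` for which a coset selected by `x`
is also selected by `xy`, and its translate by `x⁻¹` by `y`. -/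
theorem tsum_coset_selection_le (hι : Function.Injective ι) {r : K ⧸ ι.range → K}
    (hr : ∀ w, (r w : K ⧸ ι.range) = w) {B : Set M} {C : ℝ≥0∞} (hB : TrilinearBound B C)
    {P Q R : K → K ⧸ ι.range → Prop} (hP : ∀ x w w', P x w → P x w' → w = w')
    (hQ : ∀ x w w', Q x w → Q x w' → w = w') (hR : ∀ x w w', R x w → R x w' → w = w')
    (φ ψ χ : K → ℝ≥0)
    (hφ : ∀ w w' a, P (r w * ι a * (r w')⁻¹) w → φ (r w * ι a * (r w')⁻¹) ≠ 0 → a ∈ B) :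
    ∑' w, ∑' x, ∑' y, (if P x w ∧ Q y (x⁻¹ • w) ∧ R (x * y) w then
        (φ x * ψ y * χ (x * y) : ℝ≥0∞) else 0) ≤
      C * (enormTwo (fun x => (φ x : ℝ≥0∞)) * enormTwo (fun x => (ψ x : ℝ≥0∞)) *
        enormTwo (fun x => (χ x : ℝ≥0∞))) := by
  refine le_trans ?_ ((tsum_coset_trilinear_le hι hr hB (fun w x => if P x w then φ x else 0)
    (fun w x => if Q x w then ψ x else 0) (fun w x => if R x w then χ x else 0) ?_).trans ?_)
  · gcongr with w x y
    split_ifs with h <;> simp_all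
  · intro w w' a h
    simp only [ne_eq, ite_eq_right_iff, Classical.not_imp] at h
    exact hφ w w' a h.1 h.2
  · gcongr
    · exact enormTwo_indicator_le hP φ
    · exact enormTwo_indicator_le hQ ψ
    · exact enormTwo_indicator_le hR χ

end Cosets

/-! ### Geodesics and medians in trees -/

section Trees

open SimpleGraph

variable {V : Type*} {T : SimpleGraph V}

theorem length_eq_dist_of_isPath (hT : T.IsTree) {a b : V} {p : T.Walk a b} (hp : p.IsPath) :
    p.length = T.dist a b := by
  obtain ⟨q, hq, hl⟩ := hT.connected.exists_path_of_dist a b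
  rw [(hT.existsUnique_path a b).unique hp hq, hl]

/-- Geodesics through `w` concatenate to the unique path from `a` to `b`, and the support of every
walk contains that of its bypass, which is this path. -/
theorem mem_support_of_dist_add_dist (hT : T.IsTree) {a b w : V}
    (hw : T.dist a w + T.dist w b = T.dist a b) (p : T.Walk a b) : w ∈ p.support := by
  classical
  obtain ⟨q, -, hq⟩ := hT.connected.exists_path_of_dist a w
  obtain ⟨q', -, hq'⟩ := hT.connected.exists_path_of_dist w b
  have h1 : (q.append q').IsPath := by
    apply Walk.isPath_of_length_eq_dist
    rw [Walk.length_append, hq, hq', hw]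
  have h2 := (hT.existsUnique_path a b).unique h1 p.bypass_isPath
  apply p.support_bypass_subset_support
  rw [← h2]
  simp

theorem eq_of_dist_eq_of_between (hT : T.IsTree) {a b w w' : V}
    (hw : T.dist a w + T.dist w b = T.dist a b) (hw' : T.dist a w' + T.dist w' b = T.dist a b)
    (h : T.dist a w = T.dist a w') : w = w' := by
  obtain ⟨p, hp, -⟩ := hT.connected.exists_path_of_dist a b
  have key : ∀ x, T.dist a x + T.dist x b = T.dist a b → p.getVert (T.dist a x) = x := by
    intro x hx
    obtain ⟨q, -, hq⟩ := hT.connected.exists_path_of_dist a x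
    obtain ⟨q', -, hq'⟩ := hT.connected.exists_path_of_dist x b
    have h1 : (q.append q').IsPath := by
      apply Walk.isPath_of_length_eq_dist
      rw [Walk.length_append, hq, hq', hx]
    rw [(hT.existsUnique_path a b).unique hp h1, Walk.getVert_append, hq]
    simp
  rw [← key w hw, ← key w' hw', h]

theorem isPath_append {a b c : V} {p : T.Walk a b} {q : T.Walk b c} (hp : p.IsPath)
    (hq : q.IsPath) (h : ∀ x ∈ p.support, x ∈ q.support → x = b) : (p.append q).IsPath := by
  rw [Walk.isPath_def, Walk.support_append]
  refine List.Nodup.append hp.support_nodup hq.support_nodup.tail ?_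
  intro x hx hx'
  have hb := h x hx (List.mem_of_mem_tail hx')
  subst hb
  have := hq.support_nodup
  rw [← Walk.cons_tail_support] at this
  exact (List.nodup_cons.1 this).1 hx'

theorem exists_walk_first_hit (S : Set V) {a b : V} (p : T.Walk a b) (hb : b ∈ S) :
    ∃ c ∈ S, ∃ q : T.Walk a c, ∀ x ∈ q.support, x ∈ S → x = c := by
  induction p with
  | nil => exact ⟨_, hb, Walk.nil, by simp⟩
  | @cons u v w h p ih =>
    by_cases hu : u ∈ S
    · exact ⟨u, hu, Walk.nil, by simp⟩
    · obtain ⟨c, hc, q, hq⟩ := ih hb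
      refine ⟨c, hc, Walk.cons h q, ?_⟩
      intro x hx hxS
      rw [Walk.support_cons, List.mem_cons] at hx
      rcases hx with rfl | hx
      · exact absurd hxS hu
      · exact hq x hx hxS

/-- The median is the first vertex at which a walk from `c` meets the path from `a` to `b`. The leg
from `c` meets that path only there, so its concatenations with the two halves are paths, hence
geodesics. -/
theorem exists_median (hT : T.IsTree) (a b c : V) : ∃ w,
    T.dist a w + T.dist w b = T.dist a b ∧ T.dist a w + T.dist w c = T.dist a c ∧
      T.dist b w + T.dist w c = T.dist b c := by
  classical
  obtain ⟨p, hp, -⟩ := hT.connected.exists_path_of_dist a b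
  obtain ⟨q₀, -, -⟩ := hT.connected.exists_path_of_dist c a
  obtain ⟨w, hw, q, hq⟩ := exists_walk_first_hit {x | x ∈ p.support} q₀ p.start_mem_support
  have hw' : w ∈ p.support := hw
  have h1 : T.dist c w + T.dist w b = T.dist c b := by
    have := isPath_append q.bypass_isPath (hp.dropUntil hw') fun x hx hx' =>
      hq x (q.support_bypass_subset_support hx) (p.support_dropUntil_subset_support hw' hx')
    have hl := length_eq_dist_of_isPath hT this
    rwa [Walk.length_append, length_eq_dist_of_isPath hT q.bypass_isPath,
      length_eq_dist_of_isPath hT (hp.dropUntil hw')] at hl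
  have h2 : T.dist c w + T.dist w a = T.dist c a := by
    have := isPath_append q.bypass_isPath (hp.takeUntil hw').reverse fun x hx hx' =>
      hq x (q.support_bypass_subset_support hx)
        (p.support_takeUntil_subset_support hw' (by simpa using hx'))
    have hl := length_eq_dist_of_isPath hT this
    rwa [Walk.length_append, length_eq_dist_of_isPath hT q.bypass_isPath,
      length_eq_dist_of_isPath hT (hp.takeUntil hw').reverse] at hl
  have h3 : T.dist a w + T.dist w b = T.dist a b := by
    have hl := congrArg Walk.length (p.take_spec hw')
    rwa [Walk.length_append, length_eq_dist_of_isPath hT (hp.takeUntil hw'),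
      length_eq_dist_of_isPath hT (hp.dropUntil hw'), length_eq_dist_of_isPath hT hp] at hl
  refine ⟨w, h3, ?_, ?_⟩
  · rw [T.dist_comm (u := a) (v := w), T.dist_comm (u := w) (v := c),
      T.dist_comm (u := a) (v := c), add_comm, h2]
  · rw [T.dist_comm (u := b) (v := w), T.dist_comm (u := w) (v := c),
      T.dist_comm (u := b) (v := c), add_comm, h1]

theorem dist_map_equiv (hT : T.Connected) (e : T ≃g T) (a b : V) :
    T.dist (e a) (e b) = T.dist a b := by
  have le : ∀ (f : T →g T) (x y : V), T.dist (f x) (f y) ≤ T.dist x y := by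
    intro f x y
    obtain ⟨p, -, hp⟩ := hT.exists_path_of_dist x y
    rw [← hp, ← Walk.length_map f p]
    exact dist_le _
  refine le_antisymm (le e.toHom a b) ?_
  simpa using le e.symm.toHom (e a) (e b)

end Trees

/-! ### The Bass–Serre tree of an amalgamated free product -/

section BassSerre

variable {G H : Type u} {A : Type v} [Group G] [Group H] [Group A] (i : A →* G) (j : A →* H)

/-- The common subgroup, inside the amalgamated free product. -/
def Amalgam.baseHom : A →* Amalgam i j := Monoid.PushoutI.base (pairHom i j)

theorem Amalgam.inl_base (a : A) : Amalgam.inl i j (i a) = Amalgam.baseHom i j a :=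
  Monoid.PushoutI.of_apply_eq_base (pairHom i j) false a

theorem Amalgam.inr_base (a : A) : Amalgam.inr i j (j a) = Amalgam.baseHom i j a :=
  Monoid.PushoutI.of_apply_eq_base (pairHom i j) true a

theorem Amalgam.inl_injective (hi : Function.Injective i) (hj : Function.Injective j) :
    Function.Injective (Amalgam.inl i j) :=
  Monoid.PushoutI.of_injective (φ := pairHom i j) (fun b => by cases b <;> assumption) false

theorem Amalgam.inr_injective (hi : Function.Injective i) (hj : Function.Injective j) :
    Function.Injective (Amalgam.inr i j) :=
  Monoid.PushoutI.of_injective (φ := pairHom i j) (fun b => by cases b <;> assumption) true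

/-- The universal property of the amalgamated free product. -/
theorem Amalgam.exists_lift {P : Type*} [Group P] (f : G →* P) (h : H →* P)
    (hfh : ∀ a, f (i a) = h (j a)) :
    ∃ F : Amalgam i j →* P, (∀ x, F (Amalgam.inl i j x) = f x) ∧
      ∀ y, F (Amalgam.inr i j y) = h y := by
  let fam : ∀ b, Pair G H b →* P := fun b => match b with
    | false => f
    | true => h
  have hfam : ∀ b, (fam b).comp (pairHom i j b) = f.comp i := by
    intro b
    cases b
    · rfl
    · ext a
      exact (hfh a).symm
  exact ⟨Monoid.PushoutI.lift fam (f.comp i) hfam,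
    fun x => Monoid.PushoutI.lift_of fam _ hfam (i := false) x,
    fun y => Monoid.PushoutI.lift_of fam _ hfam (i := true) y⟩

/-- The product in `G *_A H` of a list of letters from `G` and `H`. -/
def wordProd (w : List (G ⊕ H)) : Amalgam i j :=
  (w.map (Sum.elim (Amalgam.inl i j) (Amalgam.inr i j))).prod

@[simp] theorem wordProd_nil : wordProd i j [] = 1 := rfl

@[simp] theorem wordProd_cons (x : G ⊕ H) (w : List (G ⊕ H)) :
    wordProd i j (x :: w) = Sum.elim (Amalgam.inl i j) (Amalgam.inr i j) x * wordProd i j w := by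
  simp [wordProd]

@[simp] theorem wordProd_append (w w' : List (G ⊕ H)) :
    wordProd i j (w ++ w') = wordProd i j w * wordProd i j w' := by
  simp [wordProd]

theorem exists_wordProd_eq (k : Amalgam i j) : ∃ w, wordProd i j w = k := by
  induction k using Monoid.PushoutI.induction_on with
  | of b x =>
    cases b
    · exact ⟨[Sum.inl x], by simp; rfl⟩
    · exact ⟨[Sum.inr x], by simp; rfl⟩
  | base a => exact ⟨[Sum.inl (i a)], by simpa using! Amalgam.inl_base i j a⟩
  | mul x y hx hy =>
    obtain ⟨w, rfl⟩ := hx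
    obtain ⟨w', rfl⟩ := hy
    exact ⟨w ++ w', by simp⟩

/-- The two halves into which the edge `A` cuts the Bass–Serre tree: a `G`-invariant and an
`H`-invariant two-colouring of `G *_A H` that differ exactly on `A`. -/
theorem exists_colourings : ∃ τ τ' : Amalgam i j → Bool,
    (∀ x k, τ (Amalgam.inl i j x * k) = τ k) ∧ (∀ y k, τ' (Amalgam.inr i j y * k) = τ' k) ∧
      ∀ k, τ k ≠ τ' k ↔ k ∈ (Amalgam.baseHom i j).range := by
  classical
  let K := Amalgam i j
  let flip : K → Bool → Bool := fun k b => if k ∈ (Amalgam.baseHom i j).range then !b else b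
  have flip_flip : ∀ k b, flip k (flip k b) = b := by
    intro k b
    by_cases h : k ∈ (Amalgam.baseHom i j).range <;> simp only [flip, h] <;> simp
  let θ : Equiv.Perm (K × Bool) :=
    { toFun := fun p => (p.1, flip p.1 p.2)
      invFun := fun p => (p.1, flip p.1 p.2)
      left_inv := fun p => by simp [flip_flip]
      right_inv := fun p => by simp [flip_flip] }
  let ρ : K →* Equiv.Perm (K × Bool) :=
    { toFun := fun k => (Equiv.mulLeft k).prodCongr (Equiv.refl Bool)
      map_one' := by ext p <;> simp
      map_mul' := fun x y => by ext p <;> simp [mul_assoc] }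
  have hρ : ∀ k p, ρ k p = (k * p.1, p.2) := fun _ _ => rfl
  have hθ : ∀ p, θ p = (p.1, flip p.1 p.2) := fun _ => rfl
  have hθ' : ∀ p, θ⁻¹ p = (p.1, flip p.1 p.2) := fun _ => rfl
  -- Two sheets over the group: `G` translates within sheets, `H` does so after conjugation by the
  -- swap `θ` of the sheets over `A`. Translations by `A` commute with `θ`, so both actions glue.
  -- The sheet of `F k (1, false)` is `G`-invariant in `k`, and its flip is `H`-invariant.
  obtain ⟨F, hF, hF'⟩ := Amalgam.exists_lift i j (ρ.comp (Amalgam.inl i j))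
    ((MulAut.conj θ).toMonoidHom.comp (ρ.comp (Amalgam.inr i j))) (by
      intro a
      ext1 p
      simp only [MonoidHom.comp_apply]
      rw [Amalgam.inl_base, Amalgam.inr_base]
      simp only [hρ, MulEquiv.coe_toMonoidHom, MulAut.conj_apply, Equiv.Perm.mul_apply, hθ, hθ']
      have : flip (Amalgam.baseHom i j a * p.1) = flip p.1 := by
        have h : Amalgam.baseHom i j a * p.1 ∈ (Amalgam.baseHom i j).range ↔
          p.1 ∈ (Amalgam.baseHom i j).range := Subgroup.mul_mem_cancel_left _ ⟨a, rfl⟩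
        simp only [flip, h]
      rw [this, flip_flip])
  have fst : ∀ k p, (F k p).1 = k * p.1 := by
    intro k
    obtain ⟨w, rfl⟩ := exists_wordProd_eq i j k
    induction w with
    | nil => simp
    | cons x w ih =>
      intro p
      rw [wordProd_cons, map_mul, Equiv.Perm.mul_apply, mul_assoc, ← ih]
      cases x with
      | inl x => simp only [Sum.elim_inl, hF]; rfl
      | inr y => simp only [Sum.elim_inr, hF']; rfl
  have eta : ∀ k, F k (1, false) = (k, (F k (1, false)).2) := by
    intro k
    conv_lhs => rw [← Prod.mk.eta (p := F k (1, false)), fst, mul_one]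
  refine ⟨fun k => (F k (1, false)).2, fun k => flip k (F k (1, false)).2, ?_, ?_, ?_⟩
  · intro x k
    simp only
    rw [map_mul, Equiv.Perm.mul_apply, hF]
    rfl
  · intro y k
    simp only
    rw [map_mul, Equiv.Perm.mul_apply, hF', eta]
    simp only [MonoidHom.comp_apply, MulEquiv.coe_toMonoidHom, MulAut.conj_apply,
      Equiv.Perm.mul_apply, hθ, hθ', hρ, flip_flip]
  · intro k
    by_cases h : k ∈ (Amalgam.baseHom i j).range <;> simp only [flip, h] <;> simp

/-- The vertices of the Bass–Serre tree. -/
abbrev BassSerreVertex : Type _ :=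
  (Amalgam i j ⧸ (Amalgam.inl i j).range) ⊕ (Amalgam i j ⧸ (Amalgam.inr i j).range)

/-- The vertex `kG`. -/
def leftVertex (k : Amalgam i j) : BassSerreVertex i j := Sum.inl (k : _ ⧸ _)

/-- The vertex `kH`. -/
def rightVertex (k : Amalgam i j) : BassSerreVertex i j := Sum.inr (k : _ ⧸ _)

/-- The Bass–Serre tree, with an edge from `kG` to `kH` for each `k`. -/
def bassSerreTree : SimpleGraph (BassSerreVertex i j) where
  Adj v w := ∃ k, (v = leftVertex i j k ∧ w = rightVertex i j k) ∨
    (v = rightVertex i j k ∧ w = leftVertex i j k)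
  symm := ⟨by
    rintro v w ⟨k, h | h⟩
    · exact ⟨k, Or.inr ⟨h.2, h.1⟩⟩
    · exact ⟨k, Or.inl ⟨h.2, h.1⟩⟩⟩
  loopless := ⟨by
    rintro v ⟨k, ⟨rfl, h⟩ | ⟨rfl, h⟩⟩ <;> cases h⟩

theorem leftVertex_mul_inl (k : Amalgam i j) (x : G) :
    leftVertex i j (k * Amalgam.inl i j x) = leftVertex i j k := by
  refine congrArg Sum.inl (QuotientGroup.eq.2 ?_)
  exact ⟨x⁻¹, by simp⟩

theorem rightVertex_mul_inr (k : Amalgam i j) (y : H) :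
    rightVertex i j (k * Amalgam.inr i j y) = rightVertex i j k := by
  refine congrArg Sum.inr (QuotientGroup.eq.2 ?_)
  exact ⟨y⁻¹, by simp⟩

theorem bassSerreTree_adj (k : Amalgam i j) :
    (bassSerreTree i j).Adj (leftVertex i j k) (rightVertex i j k) :=
  ⟨k, Or.inl ⟨rfl, rfl⟩⟩

/-- Every edge is a bridge. Colour `kG` by `τ (k⁻¹ * k₀)` and `kH` by `τ' (k⁻¹ * k₀)`: the ends of
the edge `k` differ in colour exactly when `k⁻¹ * k₀` lies in `A`, that is, when it is the edge
`k₀`. A walk avoiding that edge cannot change colour. -/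
theorem bassSerreTree_isAcyclic : (bassSerreTree i j).IsAcyclic := by
  rw [SimpleGraph.isAcyclic_iff_forall_adj_isBridge]
  obtain ⟨τ, τ', hτ, hτ', hA⟩ := exists_colourings i j
  have main : ∀ k₀, (bassSerreTree i j).IsBridge s(leftVertex i j k₀, rightVertex i j k₀) := by
    intro k₀
    let c : BassSerreVertex i j → Bool := Sum.elim
      (Quotient.lift (fun k : Amalgam i j => τ (k⁻¹ * k₀)) (by
        intro a b hab
        obtain ⟨x, hx⟩ := QuotientGroup.leftRel_apply.1 hab
        have : b⁻¹ * k₀ = Amalgam.inl i j x⁻¹ * (a⁻¹ * k₀) := by rw [map_inv, hx]; group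
        simp only [this, hτ]))
      (Quotient.lift (fun k : Amalgam i j => τ' (k⁻¹ * k₀)) (by
        intro a b hab
        obtain ⟨x, hx⟩ := QuotientGroup.leftRel_apply.1 hab
        have : b⁻¹ * k₀ = Amalgam.inr i j x⁻¹ * (a⁻¹ * k₀) := by rw [map_inv, hx]; group
        simp only [this, hτ']))
    have cl : ∀ k, c (leftVertex i j k) = τ (k⁻¹ * k₀) := fun _ => rfl
    have cr : ∀ k, c (rightVertex i j k) = τ' (k⁻¹ * k₀) := fun _ => rfl
    rw [SimpleGraph.isBridge_iff_forall_walk_mem_edges]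
    intro p
    by_contra hp
    have const : ∀ {v w} (q : (bassSerreTree i j).Walk v w),
        s(leftVertex i j k₀, rightVertex i j k₀) ∉ q.edges → c v = c w := by
      intro v w q
      induction q with
      | nil => intro _; rfl
      | @cons a b d h q ih =>
        intro hq
        rw [SimpleGraph.Walk.edges_cons, List.mem_cons, not_or] at hq
        rw [← ih hq.2]
        have edge : ∀ k, s(leftVertex i j k₀, rightVertex i j k₀) ≠
            s(leftVertex i j k, rightVertex i j k) →
            c (leftVertex i j k) = c (rightVertex i j k) := by
          intro k hk
          by_contra hne
          rw [cl, cr] at hne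
          obtain ⟨a, ha⟩ := (hA _).1 hne
          apply hk
          have hl : k₀ = k * Amalgam.inl i j (i a) := by rw [Amalgam.inl_base, ha]; group
          have hr : k₀ = k * Amalgam.inr i j (j a) := by rw [Amalgam.inr_base, ha]; group
          have hl' : leftVertex i j k₀ = leftVertex i j k := by rw [hl, leftVertex_mul_inl]
          have hr' : rightVertex i j k₀ = rightVertex i j k := by rw [hr, rightVertex_mul_inr]
          rw [hl', hr']
        obtain ⟨k, ⟨rfl, rfl⟩ | ⟨rfl, rfl⟩⟩ := h
        · exact edge k hq.1
        · exact (edge k (by rw [Sym2.eq_swap (a := leftVertex i j k)]; exact hq.1)).symm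
    have := const p hp
    rw [cl, cr] at this
    refine (hA _).2 ?_ this
    simp
  rintro v w ⟨k, ⟨rfl, rfl⟩ | ⟨rfl, rfl⟩⟩
  · exact main k
  · rw [Sym2.eq_swap]
    exact main k

open Classical in
/-- The number of letters of a word that come from `H` but not from `A`. -/
noncomputable def rightCount (w : List (G ⊕ H)) : ℕ :=
  (w.map (Sum.elim (fun _ => 0) (fun y => if y ∈ j.range then 0 else 1))).sum

/-- A word in the letters from `G` and `H` traces a walk in the Bass–Serre tree, each vertex of
which contains the product of an initial segment. -/
theorem exists_walk_of_word (w : List (G ⊕ H)) (k : Amalgam i j) :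
    ∃ p : (bassSerreTree i j).Walk (leftVertex i j k) (leftVertex i j (k * wordProd i j w)),
      p.length ≤ 2 * rightCount j w ∧ ∀ v ∈ p.support, ∃ w₁ w₂, w = w₁ ++ w₂ ∧
        (v = leftVertex i j (k * wordProd i j w₁) ∨ v = rightVertex i j (k * wordProd i j w₁)) := by
  induction w generalizing k with
  | nil =>
    rw [show k * wordProd i j [] = k by simp]
    refine ⟨SimpleGraph.Walk.nil, by simp, ?_⟩
    intro v hv
    refine ⟨[], [], rfl, Or.inl ?_⟩
    simpa using hv
  | cons x w ih =>
    obtain ⟨p, hp, hv⟩ := ih (k * Sum.elim (Amalgam.inl i j) (Amalgam.inr i j) x)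
    have hend : k * Sum.elim (Amalgam.inl i j) (Amalgam.inr i j) x * wordProd i j w =
        k * wordProd i j (x :: w) := by rw [wordProd_cons, mul_assoc]
    have hv' : ∀ v ∈ p.support, ∃ w₁ w₂, x :: w = w₁ ++ w₂ ∧
        (v = leftVertex i j (k * wordProd i j w₁) ∨
          v = rightVertex i j (k * wordProd i j w₁)) := by
      intro v hvp
      obtain ⟨w₁, w₂, rfl, h⟩ := hv v hvp
      refine ⟨x :: w₁, w₂, rfl, ?_⟩
      rwa [wordProd_cons, ← mul_assoc]
    have stay : leftVertex i j k =
          leftVertex i j (k * Sum.elim (Amalgam.inl i j) (Amalgam.inr i j) x) →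
        ∃ p : (bassSerreTree i j).Walk (leftVertex i j k)
          (leftVertex i j (k * wordProd i j (x :: w))),
          p.length ≤ 2 * rightCount j (x :: w) ∧ ∀ v ∈ p.support, ∃ w₁ w₂, x :: w = w₁ ++ w₂ ∧
            (v = leftVertex i j (k * wordProd i j w₁) ∨
              v = rightVertex i j (k * wordProd i j w₁)) := by
      intro hs
      refine ⟨p.copy hs.symm (by rw [hend]), ?_, ?_⟩
      · rw [SimpleGraph.Walk.length_copy]
        refine hp.trans ?_
        simp [rightCount]
      · intro v hvp
        rw [SimpleGraph.Walk.support_copy] at hvp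
        exact hv' v hvp
    cases x with
    | inl x => exact stay (leftVertex_mul_inl i j k x).symm
    | inr y =>
      by_cases hy : y ∈ j.range
      · obtain ⟨a, rfl⟩ := hy
        refine stay ?_
        rw [Sum.elim_inr, Amalgam.inr_base, ← Amalgam.inl_base, leftVertex_mul_inl]
      -- Only a letter of `H` outside `A` moves the vertex `kG`; it does so in two edges, through
      -- `kH`.
      · have e1 : (bassSerreTree i j).Adj (leftVertex i j k) (rightVertex i j k) :=
          bassSerreTree_adj i j k
        have e2 : (bassSerreTree i j).Adj (rightVertex i j k)
            (leftVertex i j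
              (k * Sum.elim (Amalgam.inl i j) (Amalgam.inr i j) (Sum.inr y))) := by
          rw [Sum.elim_inr, ← rightVertex_mul_inr i j k y]
          exact (bassSerreTree_adj i j _).symm
        refine ⟨(SimpleGraph.Walk.cons e1 (SimpleGraph.Walk.cons e2 p)).copy rfl (by rw [hend]),
          ?_, ?_⟩
        · rw [SimpleGraph.Walk.length_copy]
          simp only [SimpleGraph.Walk.length_cons]
          have : rightCount j (Sum.inr y :: w : List (G ⊕ H)) = 1 + rightCount j w := by
            simp [rightCount, hy]
          omega
        · intro v hvp
          rw [SimpleGraph.Walk.support_copy, SimpleGraph.Walk.support_cons,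
            SimpleGraph.Walk.support_cons, List.mem_cons, List.mem_cons] at hvp
          rcases hvp with rfl | rfl | hvp
          · exact ⟨[], _, rfl, Or.inl (by simp)⟩
          · exact ⟨[], _, rfl, Or.inr (by simp)⟩
          · exact hv' v hvp

theorem bassSerreTree_isTree : (bassSerreTree i j).IsTree := by
  refine ⟨?_, bassSerreTree_isAcyclic i j⟩
  have hl : ∀ k, (bassSerreTree i j).Reachable (leftVertex i j 1) (leftVertex i j k) := by
    intro k
    obtain ⟨w, rfl⟩ := exists_wordProd_eq i j k
    obtain ⟨p, -⟩ := exists_walk_of_word i j w 1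
    rw [one_mul] at p
    exact p.reachable
  have hall : ∀ v, (bassSerreTree i j).Reachable (leftVertex i j 1) v := by
    rintro (v | v)
    · obtain ⟨k, rfl⟩ := QuotientGroup.mk_surjective v
      exact hl k
    · obtain ⟨k, rfl⟩ := QuotientGroup.mk_surjective v
      exact (hl k).trans (bassSerreTree_adj i j k).reachable
  exact (SimpleGraph.connected_iff_exists_forall_reachable _).2 ⟨_, hall⟩

/-- The action of the amalgamated free product on its Bass–Serre tree. -/
def bassSerreIso (k : Amalgam i j) : bassSerreTree i j ≃g bassSerreTree i j where
  toEquiv := MulAction.toPerm k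
  map_rel_iff' := by
    have : ∀ (k : Amalgam i j) (v w : BassSerreVertex i j), (bassSerreTree i j).Adj v w →
        (bassSerreTree i j).Adj (k • v) (k • w) := by
      rintro k v w ⟨k', ⟨rfl, rfl⟩ | ⟨rfl, rfl⟩⟩
      · exact ⟨k * k', Or.inl ⟨rfl, rfl⟩⟩
      · exact ⟨k * k', Or.inr ⟨rfl, rfl⟩⟩
    intro v w
    refine ⟨fun h => ?_, this k v w⟩
    have := this k⁻¹ _ _ h
    simpa using this

theorem dist_smul (k : Amalgam i j) (v w : BassSerreVertex i j) :
    (bassSerreTree i j).dist (k • v) (k • w) = (bassSerreTree i j).dist v w :=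
  dist_map_equiv (bassSerreTree_isTree i j).connected (bassSerreIso i j k) v w

/-- The tree is bipartite, so the distance of a median from the base vertex reveals whether it is a
coset of `G` or of `H`. -/
theorem even_dist_iff_isLeft (v : BassSerreVertex i j) :
    Even ((bassSerreTree i j).dist (leftVertex i j 1) v) ↔ v.isLeft = true := by
  let c : (bassSerreTree i j).Coloring Bool := SimpleGraph.Coloring.mk Sum.isLeft (by
    rintro v w ⟨k, ⟨rfl, rfl⟩ | ⟨rfl, rfl⟩⟩ <;> simp [leftVertex, rightVertex])
  obtain ⟨p, -, hp⟩ := (bassSerreTree_isTree i j).connected.exists_path_of_dist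
    (leftVertex i j 1) v
  rw [← hp, c.even_length_iff_congr p]
  change ((true : Bool) = true ↔ Sum.isLeft v = true) ↔ _
  simp

end BassSerre

/-! ### The universal length -/

section UniversalLength

variable {G H : Type u} {A : Type v} [Group G] [Group H] [Group A] {i : A →* G} {j : A →* H}
  {LG : G → ℕ} {LH : H → ℕ}

/-- The total length of a list of letters. -/
def wordCost (LG : G → ℕ) (LH : H → ℕ) (w : List (G ⊕ H)) : ℕ := (w.map (Sum.elim LG LH)).sum

theorem wordCost_append {G H : Type u} {LG : G → ℕ} {LH : H → ℕ} (w w' : List (G ⊕ H)) :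
    wordCost LG LH (w ++ w') = wordCost LG LH w + wordCost LG LH w' := by
  simp [wordCost]

theorem universalLength_wordProd_le (w : List (G ⊕ H)) :
    universalLength i j LG LH (wordProd i j w) ≤ wordCost LG LH w :=
  Nat.sInf_le ⟨w, rfl, rfl⟩

theorem exists_word_eq_universalLength (i : A →* G) (j : A →* H) (LG : G → ℕ) (LH : H → ℕ)
    (k : Amalgam i j) :
    ∃ w, wordProd i j w = k ∧ wordCost LG LH w = universalLength i j LG LH k := by
  obtain ⟨w, hw⟩ := exists_wordProd_eq i j k
  exact Nat.sInf_mem (s := {n | ∃ w, wordProd i j w = k ∧ wordCost LG LH w = n}) ⟨_, w, hw, rfl⟩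

theorem isLength_universalLength (hLG : IsLength LG) (hLH : IsLength LH) :
    IsLength (universalLength i j LG LH) where
  map_one := Nat.le_zero.1 (universalLength_wordProd_le (i := i) (j := j) (LG := LG) (LH := LH) [])
  map_inv := by
    have le : ∀ k, universalLength i j LG LH k⁻¹ ≤ universalLength i j LG LH k := by
      intro k
      obtain ⟨w, rfl, hw⟩ := exists_word_eq_universalLength i j LG LH k
      rw [← hw]
      have inv : ∀ w : List (G ⊕ H), ∃ w', wordProd i j w' = (wordProd i j w)⁻¹ ∧
          wordCost LG LH w' = wordCost LG LH w := by
        intro w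
        induction w with
        | nil => exact ⟨[], by simp, rfl⟩
        | cons x w ih =>
          obtain ⟨w', h1, h2⟩ := ih
          refine ⟨w' ++ [Sum.map (·⁻¹) (·⁻¹) x], ?_, ?_⟩
          · cases x <;> simp [h1]
          · rw [wordCost_append, h2]
            cases x <;> simp [wordCost, hLG.map_inv, hLH.map_inv, add_comm]
      obtain ⟨w', h1, h2⟩ := inv w
      rw [← h1, ← h2]
      exact universalLength_wordProd_le w'
    intro k
    refine le_antisymm (le k) ?_
    simpa using le k⁻¹
  map_mul_le := by
    intro x y
    obtain ⟨w, rfl, hw⟩ := exists_word_eq_universalLength i j LG LH x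
    obtain ⟨w', rfl, hw'⟩ := exists_word_eq_universalLength i j LG LH y
    rw [← hw, ← hw', ← wordCost_append, ← wordProd_append]
    exact universalLength_wordProd_le _

theorem universalLength_mono {LG' : G → ℕ} {LH' : H → ℕ} (hG : ∀ x, LG x ≤ LG' x)
    (hH : ∀ y, LH y ≤ LH' y) (k : Amalgam i j) :
    universalLength i j LG LH k ≤ universalLength i j LG' LH' k := by
  obtain ⟨w, rfl, hw⟩ := exists_word_eq_universalLength i j LG' LH' k
  rw [← hw]
  refine (universalLength_wordProd_le w).trans ?_
  unfold wordCost
  refine List.sum_le_sum fun x _ => ?_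
  cases x
  · exact hG _
  · exact hH _

theorem rightCount_le_wordCost (hpos : PositiveOffAmalgam i j LG LH) (w : List (G ⊕ H)) :
    rightCount j w ≤ wordCost LG LH w := by
  unfold rightCount wordCost
  refine List.sum_le_sum fun x _ => ?_
  cases x with
  | inl x => exact Nat.zero_le _
  | inr y =>
    by_cases hy : y ∈ j.range
    · simp [hy]
    · simpa [hy] using hpos.2 y hy

/-- The base vertex of the Bass–Serre tree. -/
def baseVertex (i : A →* G) (j : A →* H) : BassSerreVertex i j := leftVertex i j 1

theorem smul_baseVertex (k : Amalgam i j) : k • baseVertex i j = leftVertex i j k :=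
  congrArg (leftVertex i j) (mul_one k)

/-- Positivity off `A` enters here: it makes only finitely many distances occur for elements of
bounded length. -/
theorem dist_baseVertex_le (hpos : PositiveOffAmalgam i j LG LH) (k : Amalgam i j) :
    (bassSerreTree i j).dist (baseVertex i j) (k • baseVertex i j) ≤
      2 * universalLength i j LG LH k := by
  obtain ⟨w, rfl, hw⟩ := exists_word_eq_universalLength i j LG LH k
  obtain ⟨p, hp, -⟩ := exists_walk_of_word i j w 1
  rw [← hw, smul_baseVertex]
  have := rightCount_le_wordCost hpos w
  have hd := (SimpleGraph.dist_le p).trans hp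
  rw [one_mul] at hd
  exact hd.trans (by omega)

/-- The vertex `v` lies at distance `l` from the base vertex, on the geodesic from there to its
translate by `k`. -/
def OnGeodesic (k : Amalgam i j) (l : ℕ) (v : BassSerreVertex i j) : Prop :=
  (bassSerreTree i j).dist (baseVertex i j) v = l ∧
    (bassSerreTree i j).dist (baseVertex i j) v + (bassSerreTree i j).dist v (k • baseVertex i j) =
      (bassSerreTree i j).dist (baseVertex i j) (k • baseVertex i j)

theorem OnGeodesic.unique {k : Amalgam i j} {l : ℕ} {v v' : BassSerreVertex i j}
    (h : OnGeodesic k l v) (h' : OnGeodesic k l v') : v = v' :=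
  eq_of_dist_eq_of_between (bassSerreTree_isTree i j) h.2 h'.2 (h.1.trans h'.1.symm)

/-- A word of minimal length for `k` passes through each vertex of the geodesic from the base
vertex to its translate by `k`. -/
theorem OnGeodesic.exists_mul_eq {k : Amalgam i j} {l : ℕ} {v : BassSerreVertex i j}
    (h : OnGeodesic k l v) (LG : G → ℕ) (LH : H → ℕ) : ∃ x y, k = x * y ∧
      (v = leftVertex i j x ∨ v = rightVertex i j x) ∧
      universalLength i j LG LH x + universalLength i j LG LH y ≤ universalLength i j LG LH k := by
  obtain ⟨w, rfl, hw⟩ := exists_word_eq_universalLength i j LG LH k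
  obtain ⟨p, -, hv⟩ := exists_walk_of_word i j w 1
  have hmem := mem_support_of_dist_add_dist (bassSerreTree_isTree i j)
    (a := leftVertex i j 1) (b := leftVertex i j (1 * wordProd i j w)) (w := v)
    (by rw [one_mul, ← smul_baseVertex (wordProd i j w)]; exact h.2) p
  obtain ⟨w₁, w₂, rfl, hv'⟩ := hv v hmem
  rw [one_mul] at hv'
  refine ⟨wordProd i j w₁, wordProd i j w₂, by simp, hv', ?_⟩
  rw [← hw, wordCost_append]
  exact add_le_add (universalLength_wordProd_le _) (universalLength_wordProd_le _)

/-- Any two elements `x` and `y` select a common vertex, the median of the translates of the base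
vertex by `1`, `x` and `xy`. -/
theorem exists_onGeodesic (x y : Amalgam i j) : ∃ l s v,
    l ≤ (bassSerreTree i j).dist (baseVertex i j) (x • baseVertex i j) ∧
    s ≤ (bassSerreTree i j).dist (baseVertex i j) (x • baseVertex i j) ∧
    OnGeodesic x l v ∧ OnGeodesic y s (x⁻¹ • v) ∧ OnGeodesic (x * y) l v := by
  obtain ⟨v, h1, h2, h3⟩ := exists_median (bassSerreTree_isTree i j) (baseVertex i j)
    (x • baseVertex i j) ((x * y) • baseVertex i j)
  have e1 : (bassSerreTree i j).dist (baseVertex i j) (x⁻¹ • v) =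
      (bassSerreTree i j).dist v (x • baseVertex i j) := by
    rw [← dist_smul i j x, smul_inv_smul, SimpleGraph.dist_comm]
  have e2 : (bassSerreTree i j).dist (x⁻¹ • v) (y • baseVertex i j) =
      (bassSerreTree i j).dist v ((x * y) • baseVertex i j) := by
    rw [← dist_smul i j x, smul_inv_smul, mul_smul]
  have e3 : (bassSerreTree i j).dist (baseVertex i j) (y • baseVertex i j) =
      (bassSerreTree i j).dist (x • baseVertex i j) ((x * y) • baseVertex i j) := by
    rw [← dist_smul i j x, mul_smul]
  refine ⟨_, (bassSerreTree i j).dist v (x • baseVertex i j), v, by omega, by omega,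
    ⟨rfl, h1⟩, ⟨e1, ?_⟩, ⟨rfl, h2⟩⟩
  rw [e1, e2, e3, ← h3, (bassSerreTree i j).dist_comm (u := x • baseVertex i j) (v := v)]

/-- Shortest representatives are no longer than any prefix or inverted suffix of a minimal word
lying in the same coset. -/
theorem exists_minimal_section {K : Type*} [Group K] (N : Subgroup K) (L : K → ℕ) :
    ∃ r : K ⧸ N → K, (∀ w, (r w : K ⧸ N) = w) ∧ ∀ k : K, L (r k) ≤ L k := by
  have h : ∀ w : K ⧸ N, ∃ k : K, (k : K ⧸ N) = w ∧ ∀ k' : K, (k' : K ⧸ N) = w → L k ≤ L k' := by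
    intro w
    have hne : {k : K | (k : K ⧸ N) = w}.Nonempty := QuotientGroup.mk_surjective w
    refine ⟨Function.argminOn L _ hne, Function.argminOn_mem L _ hne, fun k' hk' => ?_⟩
    exact Function.argminOn_le L _ hk'
  choose r hr hr' using h
  exact ⟨r, hr, fun k => hr' _ k rfl⟩

open Classical in
/-- The contribution to a trilinear sum on the amalgamated free product of the pairs `(x, y)`
whose median is a coset of one of the two factors, at given distances. -/
theorem tsum_onGeodesic_le (hL : IsLength (universalLength i j LG LH)) {M : Type*} [Group M]
    {ι : M →* Amalgam i j} (hι : Function.Injective ι)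
    {vert : Amalgam i j ⧸ ι.range → BassSerreVertex i j} (hvert : Function.Injective vert)
    (hmem : ∀ w k, vert w = leftVertex i j k ∨ vert w = rightVertex i j k →
      (k : Amalgam i j ⧸ ι.range) = w) {n : ℕ} {C : ℝ≥0∞}
    (hB : TrilinearBound {a | universalLength i j LG LH (ι a) ≤ 2 * n} C)
    (φ ψ χ : Amalgam i j → ℝ≥0) (hφ : ∀ x, φ x ≠ 0 → universalLength i j LG LH x ≤ n)
    (l s : ℕ) :
    ∑' w, ∑' x, ∑' y, (if OnGeodesic x l (vert w) ∧ OnGeodesic y s (vert (x⁻¹ • w)) ∧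
        OnGeodesic (x * y) l (vert w) then (φ x * ψ y * χ (x * y) : ℝ≥0∞) else 0) ≤
      C * (enormTwo (fun x => (φ x : ℝ≥0∞)) * enormTwo (fun x => (ψ x : ℝ≥0∞)) *
        enormTwo (fun x => (χ x : ℝ≥0∞))) := by
  obtain ⟨r, hr, hmin⟩ := exists_minimal_section ι.range (universalLength i j LG LH)
  refine tsum_coset_selection_le hι hr hB (P := fun x w => OnGeodesic x l (vert w))
    (Q := fun x w => OnGeodesic x s (vert w)) (R := fun x w => OnGeodesic x l (vert w))
    (fun x w w' h h' => hvert (h.unique h')) (fun x w w' h h' => hvert (h.unique h'))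
    (fun x w w' h h' => hvert (h.unique h')) φ ψ χ ?_
  intro w w' a hgeo hne
  have hn := hφ _ hne
  -- A minimal word is cut where it passes the selected vertex: its prefix lies in the coset `w`,
  -- the inverse of its suffix in `w'`.
  obtain ⟨x, y, hxy, hv, hle⟩ := hgeo.exists_mul_eq LG LH
  have hx : (x : Amalgam i j ⧸ ι.range) = w := hmem w x hv
  have hy : ((y⁻¹ : Amalgam i j) : Amalgam i j ⧸ ι.range) = w' := by
    have h1 : ((r w : Amalgam i j) : Amalgam i j ⧸ ι.range) = x := by rw [hr, hx]
    obtain ⟨m, hm⟩ := QuotientGroup.eq.1 h1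
    rw [← hr w', QuotientGroup.eq]
    refine ⟨m⁻¹ * a, ?_⟩
    rw [map_mul, map_inv, hm]
    have : y = x⁻¹ * (r w * ι a * (r w')⁻¹) := by rw [hxy]; group
    rw [this]
    group
  -- Together the two representatives cost at most `n`, and the element itself at most `n`; this is
  -- the `2 * n` of the middle entry.
  have h1 : universalLength i j LG LH (r w) ≤ universalLength i j LG LH x := by
    rw [← hx]; exact hmin x
  have h2 : universalLength i j LG LH (r w') ≤ universalLength i j LG LH y := by
    rw [← hy, ← hL.map_inv y]; exact hmin y⁻¹
  have h3 : ι a = (r w)⁻¹ * (r w * ι a * (r w')⁻¹) * r w' := by group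
  have h4 := hL.map_mul_le ((r w)⁻¹ * (r w * ι a * (r w')⁻¹)) (r w')
  have h5 := hL.map_mul_le (r w)⁻¹ (r w * ι a * (r w')⁻¹)
  rw [← h3] at h4
  rw [hL.map_inv] at h5
  show universalLength i j LG LH (ι a) ≤ 2 * n
  omega

/-- Trilinear estimates on the two factors give one on the amalgamated free product. -/
theorem trilinearBound_amalgam (hi : Function.Injective i) (hj : Function.Injective j)
    (hLG : IsLength LG) (hLH : IsLength LH) (hpos : PositiveOffAmalgam i j LG LH) {n : ℕ}
    {C : ℝ≥0∞} (hG : TrilinearBound {x | universalLengthLeft i j LG LH x ≤ 2 * n} C)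
    (hH : TrilinearBound {y | universalLengthRight i j LG LH y ≤ 2 * n} C) :
    TrilinearBound {k | universalLength i j LG LH k ≤ n} ((2 * n + 1) ^ 2 * C) := by
  classical
  intro φ ψ χ hφ
  have hL : IsLength (universalLength i j LG LH) := isLength_universalLength hLG hLH
  set N : ℝ≥0∞ := enormTwo (fun x => (φ x : ℝ≥0∞)) * enormTwo (fun x => (ψ x : ℝ≥0∞)) *
    enormTwo (fun x => (χ x : ℝ≥0∞))
  let tG (l s : ℕ) (x y : Amalgam i j) (w : Amalgam i j ⧸ (Amalgam.inl i j).range) : ℝ≥0∞ :=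
    if OnGeodesic x l (Sum.inl w) ∧ OnGeodesic y s (Sum.inl (x⁻¹ • w)) ∧
      OnGeodesic (x * y) l (Sum.inl w) then (φ x * ψ y * χ (x * y) : ℝ≥0∞) else 0
  let tH (l s : ℕ) (x y : Amalgam i j) (w : Amalgam i j ⧸ (Amalgam.inr i j).range) : ℝ≥0∞ :=
    if OnGeodesic x l (Sum.inr w) ∧ OnGeodesic y s (Sum.inr (x⁻¹ • w)) ∧
      OnGeodesic (x * y) l (Sum.inr w) then (φ x * ψ y * χ (x * y) : ℝ≥0∞) else 0
  have sumG : ∀ l s, ∑' w, ∑' x, ∑' y, tG l s x y w ≤ C * N := fun l s =>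
    tsum_onGeodesic_le hL (Amalgam.inl_injective i j hi hj) Sum.inl_injective (by
      rintro w k (h | h)
      · exact (Sum.inl_injective h).symm
      · cases h) hG φ ψ χ hφ l s
  have sumH : ∀ l s, ∑' w, ∑' x, ∑' y, tH l s x y w ≤ C * N := fun l s =>
    tsum_onGeodesic_le hL (Amalgam.inr_injective i j hi hj) Sum.inr_injective (by
      rintro w k (h | h)
      · cases h
      · exact (Sum.inr_injective h).symm) hH φ ψ χ hφ l s
  -- The parity of `l` selects the factor, so each pair `(l, s)` costs a single `C * N`.
  let t (l s : ℕ) (x y : Amalgam i j) : ℝ≥0∞ :=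
    if Even l then ∑' w, tG l s x y w else ∑' w, tH l s x y w
  have sum_t : ∀ l s, ∑' x, ∑' y, t l s x y ≤ C * N := by
    intro l s
    by_cases hl : Even l
    · simp only [t, hl, if_true]
      refine le_trans (le_of_eq ?_) (sumG l s)
      rw [ENNReal.tsum_comm (f := fun w x => ∑' y, tG l s x y w)]
      exact tsum_congr fun x => ENNReal.tsum_comm
    · simp only [t, hl, if_false]
      refine le_trans (le_of_eq ?_) (sumH l s)
      rw [ENNReal.tsum_comm (f := fun w x => ∑' y, tH l s x y w)]
      exact tsum_congr fun x => ENNReal.tsum_comm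
  have pointwise : ∀ x y, (φ x * ψ y * χ (x * y) : ℝ≥0∞) ≤
      ∑ l ∈ Finset.range (2 * n + 1), ∑ s ∈ Finset.range (2 * n + 1), t l s x y := by
    intro x y
    by_cases hx : φ x = 0
    · simp [hx]
    have hxn : universalLength i j LG LH x ≤ n := hφ x hx
    obtain ⟨l, s, v, hl, hs, h1, h2, h3⟩ := exists_onGeodesic x y
    have hd := dist_baseVertex_le hpos x
    have hl' : l ∈ Finset.range (2 * n + 1) := Finset.mem_range.2 (by omega)
    have hs' : s ∈ Finset.range (2 * n + 1) := Finset.mem_range.2 (by omega)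
    refine le_trans ?_ (Finset.single_le_sum (f := fun l =>
      ∑ s ∈ Finset.range (2 * n + 1), t l s x y) (fun _ _ => zero_le) hl')
    refine le_trans ?_ (Finset.single_le_sum (f := fun s => t l s x y)
      (fun _ _ => zero_le) hs')
    have par : Even l ↔ v.isLeft = true := by
      rw [← h1.1]
      exact even_dist_iff_isLeft i j v
    cases v with
    | inl w =>
      have hE : Even l := par.2 rfl
      simp only [t, hE, if_true]
      refine le_trans ?_ (ENNReal.le_tsum w)
      have hc : OnGeodesic x l (Sum.inl w) ∧ OnGeodesic y s (Sum.inl (x⁻¹ • w)) ∧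
        OnGeodesic (x * y) l (Sum.inl w) := ⟨h1, h2, h3⟩
      simp only [tG, if_pos hc, le_refl]
    | inr w =>
      have hE : ¬ Even l := fun h => by simpa using par.1 h
      simp only [t, hE, if_false]
      refine le_trans ?_ (ENNReal.le_tsum w)
      have hc : OnGeodesic x l (Sum.inr w) ∧ OnGeodesic y s (Sum.inr (x⁻¹ • w)) ∧
        OnGeodesic (x * y) l (Sum.inr w) := ⟨h1, h2, h3⟩
      simp only [tH, if_pos hc, le_refl]
  calc ∑' x, ∑' y, (φ x * ψ y * χ (x * y) : ℝ≥0∞)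
      ≤ ∑' x, ∑' y, ∑ l ∈ Finset.range (2 * n + 1), ∑ s ∈ Finset.range (2 * n + 1), t l s x y := by
        gcongr; exact pointwise _ _
    _ = ∑ l ∈ Finset.range (2 * n + 1), ∑ s ∈ Finset.range (2 * n + 1),
          ∑' x, ∑' y, t l s x y := by
        simp_rw [Summable.tsum_finsetSum (fun _ _ => ENNReal.summable)]
    _ ≤ ∑ l ∈ Finset.range (2 * n + 1), ∑ s ∈ Finset.range (2 * n + 1), C * N := by
        gcongr; exact sum_t _ _
    _ = _ := by
        simp only [Finset.sum_const, Finset.card_range, nsmul_eq_mul]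
        push_cast
        ring

/-- Operator norm estimates for the two factors give one for the amalgamated free product. -/
theorem norm_regularRep_amalgam_le (hi : Function.Injective i) (hj : Function.Injective j)
    (hLG : IsLength LG) (hLH : IsLength LH) (hpos : PositiveOffAmalgam i j LG LH) {n : ℕ}
    {C : ℝ} (hC : 0 ≤ C)
    (hG : ∀ φ : MonoidAlgebra ℂ G,
      (∀ x ∈ φ.coeff.support, universalLengthLeft i j LG LH x ≤ 2 * n) →
        ‖regularRep φ‖ ≤ C * twoNorm φ)
    (hH : ∀ φ : MonoidAlgebra ℂ H,
      (∀ y ∈ φ.coeff.support, universalLengthRight i j LG LH y ≤ 2 * n) →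
        ‖regularRep φ‖ ≤ C * twoNorm φ)
    (φ : MonoidAlgebra ℂ (Amalgam i j))
    (hφ : ∀ k ∈ φ.coeff.support, universalLength i j LG LH k ≤ n) :
    ‖regularRep φ‖ ≤ (2 * n + 1) ^ 2 * C * twoNorm φ := by
  refine TrilinearBound.norm_regularRep_le (by positivity) ?_ φ hφ
  have h := trilinearBound_amalgam hi hj hLG hLH hpos
    (trilinearBound_of_norm_regularRep_le hC hG) (trilinearBound_of_norm_regularRep_le hC hH)
  have e : ENNReal.ofReal ((2 * n + 1) ^ 2 * C) = (2 * n + 1) ^ 2 * ENNReal.ofReal C := by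
    rw [ENNReal.ofReal_mul (by positivity), ENNReal.ofReal_pow (by positivity)]
    congr 2
    rw [show (2 * n + 1 : ℝ) = ((2 * n + 1 : ℕ) : ℝ) by push_cast; ring, ENNReal.ofReal_natCast]
    push_cast
    ring
  rwa [e]

end UniversalLength

/-! ### Polynomial and subexponential bounds -/

section Growth

/-- Unlike `P.eval`, the majorant is monotone, so its argument may be enlarged. -/
theorem exists_polynomial_bound (P : Polynomial ℝ) :
    ∃ c k : ℕ, ∀ n : ℕ, P.eval (n : ℝ) ≤ c * ((n : ℝ) + 1) ^ k := by
  refine ⟨⌈∑ m ∈ Finset.range (P.natDegree + 1), |P.coeff m|⌉₊, P.natDegree, fun n => ?_⟩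
  rw [Polynomial.eval_eq_sum_range]
  calc ∑ m ∈ Finset.range (P.natDegree + 1), P.coeff m * (n : ℝ) ^ m
      ≤ ∑ m ∈ Finset.range (P.natDegree + 1), |P.coeff m| * ((n : ℝ) + 1) ^ P.natDegree := by
        refine Finset.sum_le_sum fun m hm => ?_
        have h1 : (n : ℝ) ^ m ≤ ((n : ℝ) + 1) ^ P.natDegree :=
          (pow_le_pow_left₀ (by positivity) (by linarith) m).trans
            (pow_le_pow_right₀ (by linarith [n.cast_nonneg (α := ℝ)])
              (Nat.lt_succ_iff.1 (Finset.mem_range.1 hm)))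
        exact mul_le_mul (le_abs_self _) h1 (by positivity) (abs_nonneg _)
    _ = (∑ m ∈ Finset.range (P.natDegree + 1), |P.coeff m|) * ((n : ℝ) + 1) ^ P.natDegree :=
        (Finset.sum_mul _ _ _).symm
    _ ≤ _ := by
        gcongr
        exact Nat.le_ceil _

theorem exists_polynomial_bound₂ (P Q : Polynomial ℝ) :
    ∃ c k : ℕ, ∀ n : ℕ, P.eval (n : ℝ) ≤ c * ((n : ℝ) + 1) ^ k ∧
      Q.eval (n : ℝ) ≤ c * ((n : ℝ) + 1) ^ k := by
  obtain ⟨c, k, h⟩ := exists_polynomial_bound P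
  obtain ⟨c', k', h'⟩ := exists_polynomial_bound Q
  refine ⟨c + c', k + k', fun n => ⟨(h n).trans ?_, (h' n).trans ?_⟩⟩
  all_goals
    push_cast
    gcongr
    · simp
    · linarith [n.cast_nonneg (α := ℝ)]
    · simp

/-- A function is bounded by each exponential function `C exp(ε n)` with `ε > 0`. -/
def SubexpBound (f : ℕ → ℝ) : Prop :=
  ∀ ε : ℝ, 0 < ε → ∃ C : ℝ, 0 ≤ C ∧ ∀ n : ℕ, f n ≤ C * Real.exp (ε * n)

theorem subexpBound_const (c : ℝ) : SubexpBound fun _ => c := by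
  intro ε hε
  refine ⟨|c|, abs_nonneg c, fun n => ?_⟩
  have : 1 ≤ Real.exp (ε * n) := Real.one_le_exp (by positivity)
  nlinarith [le_abs_self c, abs_nonneg c]

theorem subexpBound_add_one : SubexpBound fun n => (n : ℝ) + 1 := by
  intro ε hε
  refine ⟨1 / ε + 1, by positivity, fun n => ?_⟩
  have h1 : ε * n + 1 ≤ Real.exp (ε * n) := Real.add_one_le_exp _
  have h2 : (n : ℝ) + 1 ≤ (1 / ε + 1) * (ε * n + 1) := by
    have : (1 / ε + 1) * (ε * n + 1) = n + 1 + (ε * n + 1 / ε) := by field_simp; ring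
    rw [this]
    have : 0 ≤ ε * n + 1 / ε := by positivity
    linarith
  exact h2.trans (by gcongr)

theorem SubexpBound.add {f g : ℕ → ℝ} (hf : SubexpBound f) (hg : SubexpBound g) :
    SubexpBound fun n => f n + g n := by
  intro ε hε
  obtain ⟨C, hC, hb⟩ := hf ε hε
  obtain ⟨C', hC', hb'⟩ := hg ε hε
  refine ⟨C + C', by positivity, fun n => ?_⟩
  rw [add_mul]
  exact add_le_add (hb n) (hb' n)

theorem SubexpBound.mul {f g : ℕ → ℝ} (hf : SubexpBound f) (hg : SubexpBound g)
    (hg0 : ∀ n, 0 ≤ g n) : SubexpBound fun n => f n * g n := by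
  intro ε hε
  obtain ⟨C, hC, hb⟩ := hf (ε / 2) (by positivity)
  obtain ⟨C', hC', hb'⟩ := hg (ε / 2) (by positivity)
  refine ⟨C * C', by positivity, fun n => ?_⟩
  calc f n * g n ≤ (C * Real.exp (ε / 2 * n)) * (C' * Real.exp (ε / 2 * n)) :=
        mul_le_mul (hb n) (hb' n) (hg0 n) (by positivity)
    _ = C * C' * (Real.exp (ε / 2 * n) * Real.exp (ε / 2 * n)) := by ring
    _ = C * C' * Real.exp (ε * n) := by
        rw [← Real.exp_add]
        congr 2
        ring

theorem SubexpBound.pow {f : ℕ → ℝ} (hf : SubexpBound f) (hf0 : ∀ n, 0 ≤ f n) (k : ℕ) :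
    SubexpBound fun n => f n ^ k := by
  induction k with
  | zero => simpa using subexpBound_const 1
  | succ k ih => simpa [pow_succ] using ih.mul hf hf0

theorem SubexpBound.comp_affine {f : ℕ → ℝ} (hf : SubexpBound f) (a b : ℕ) :
    SubexpBound fun n => f (a * n + b) := by
  intro ε hε
  -- Dividing by `a + 1` rather than `a` allows `a = 0`.
  obtain ⟨C, hC, hb⟩ := hf (ε / (a + 1)) (by positivity)
  refine ⟨C * Real.exp (ε / (a + 1) * b), by positivity, fun n => (hb _).trans ?_⟩
  rw [mul_assoc, ← Real.exp_add]
  gcongr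
  push_cast
  have h : ε / (a + 1) * a ≤ ε := by
    rw [div_mul_eq_mul_div, div_le_iff₀ (by positivity)]
    nlinarith
  nlinarith [n.cast_nonneg (α := ℝ)]

/-- For a non-negative function the partial sums are a monotone majorant. They cost only a factor `n
+ 1`, absorbed by half of `ε`. -/
theorem SubexpBound.sum_range {f : ℕ → ℝ} (hf : SubexpBound f) :
    SubexpBound fun n => ∑ m ∈ Finset.range (n + 1), f m := by
  have key : ∀ ε : ℝ, 0 < ε → ∃ C : ℝ, 0 ≤ C ∧ ∀ n : ℕ,
      ∑ m ∈ Finset.range (n + 1), f m ≤ ((n : ℝ) + 1) * (C * Real.exp (ε * n)) := by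
    intro ε hε
    obtain ⟨C, hC, hb⟩ := hf ε hε
    refine ⟨C, hC, fun n => ?_⟩
    have : ∀ m ∈ Finset.range (n + 1), f m ≤ C * Real.exp (ε * n) := by
      intro m hm
      refine (hb m).trans ?_
      have : m ≤ n := Nat.lt_succ_iff.1 (Finset.mem_range.1 hm)
      gcongr
    refine (Finset.sum_le_card_nsmul _ _ _ this).trans ?_
    rw [Finset.card_range, nsmul_eq_mul]
    push_cast
    rfl
  intro ε hε
  obtain ⟨C, hC, hb⟩ := key (ε / 2) (by positivity)
  obtain ⟨C', hC', hb'⟩ := subexpBound_add_one (ε / 2) (by positivity)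
  refine ⟨C' * C, by positivity, fun n => (hb n).trans ?_⟩
  calc ((n : ℝ) + 1) * (C * Real.exp (ε / 2 * n))
      ≤ (C' * Real.exp (ε / 2 * n)) * (C * Real.exp (ε / 2 * n)) := by
        gcongr
        exact hb' n
    _ = C' * C * (Real.exp (ε / 2 * n) * Real.exp (ε / 2 * n)) := by ring
    _ = C' * C * Real.exp (ε * n) := by
        rw [← Real.exp_add]
        congr 2
        ring

/-- Eventually the root is below `exp ε`; the finitely many earlier values go into the constant. -/
theorem Subexponential.subexpBound {f : ℕ → ℝ} (hf : Subexponential f) : SubexpBound f := by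
  intro ε hε
  have h1 : ∀ᶠ n : ℕ in Filter.atTop, f n ^ (1 / (n : ℝ)) < Real.exp ε :=
    hf.2.eventually_lt_const (by simpa using hε)
  obtain ⟨N, hN⟩ := Filter.eventually_atTop.1 h1
  have hS : 0 ≤ ∑ m ∈ Finset.range (N + 1), f m := Finset.sum_nonneg fun m _ => hf.1 m
  refine ⟨1 + ∑ m ∈ Finset.range (N + 1), f m, by positivity, fun n => ?_⟩
  have he : 1 ≤ Real.exp (ε * n) := Real.one_le_exp (by positivity)
  rcases lt_or_ge n (N + 1) with hn | hn
  · have : f n ≤ ∑ m ∈ Finset.range (N + 1), f m :=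
      Finset.single_le_sum (fun m _ => hf.1 m) (Finset.mem_range.2 hn)
    nlinarith
  · have hn0 : (n : ℝ) ≠ 0 := by
      have : n ≠ 0 := by omega
      exact_mod_cast this
    have h2 := (hN n (by omega)).le
    have h3 : f n = (f n ^ (1 / (n : ℝ))) ^ (n : ℝ) := by
      rw [← Real.rpow_mul (hf.1 n), one_div, inv_mul_cancel₀ hn0, Real.rpow_one]
    have h4 : f n ≤ Real.exp (ε * n) := by
      rw [h3, Real.exp_mul]
      exact Real.rpow_le_rpow (Real.rpow_nonneg (hf.1 n) _) h2 (by positivity)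
    nlinarith

/-- The lower bound `1` keeps `log (f n) / n` non-negative, while the upper bound is `log C / n + ε
/ 2`. -/
theorem SubexpBound.subexponential {f : ℕ → ℝ} (hf : SubexpBound f) (h1 : ∀ n, 1 ≤ f n) :
    Subexponential f := by
  have hpos : ∀ n, 0 < f n := fun n => zero_lt_one.trans_le (h1 n)
  refine ⟨fun n => (hpos n).le, ?_⟩
  have hlog : Filter.Tendsto (fun n : ℕ => Real.log (f n) * (1 / (n : ℝ))) Filter.atTop
      (nhds 0) := by
    rw [Metric.tendsto_atTop]
    intro ε hε
    obtain ⟨C, hC, hb⟩ := hf (ε / 2) (by positivity)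
    have hC1 : 1 ≤ C := by simpa using (h1 0).trans (hb 0)
    refine ⟨⌈Real.log C / (ε / 2)⌉₊ + 1, fun n hn => ?_⟩
    have hn1 : (0 : ℝ) < n := by
      have : 0 < n := by omega
      exact_mod_cast this
    have hn2 : Real.log C / (ε / 2) < n := by
      refine (Nat.le_ceil _).trans_lt ?_
      exact_mod_cast (by omega : ⌈Real.log C / (ε / 2)⌉₊ < n)
    have h2 : Real.log (f n) ≤ Real.log C + ε / 2 * n := by
      have := Real.log_le_log (hpos n) (hb n)
      rwa [Real.log_mul (by positivity) (Real.exp_ne_zero _), Real.log_exp] at this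
    rw [div_lt_iff₀ (by positivity)] at hn2
    have h0 : 0 ≤ Real.log (f n) := Real.log_nonneg (h1 n)
    rw [Real.dist_eq, sub_zero, abs_of_nonneg (by positivity), mul_one_div, div_lt_iff₀ hn1]
    nlinarith
  have := (Real.continuous_exp.tendsto 0).comp hlog
  rw [Real.exp_zero] at this
  refine this.congr fun n => ?_
  rw [Function.comp_apply, Real.rpow_def_of_pos (hpos n)]

end Growth

/-! ### Decay for amalgamated free products -/

section Decay

/-- Tested on the unit mass at the identity, which lies in every ball. -/
theorem HasDecay.nonneg {K : Type*} [Group K] {l : K → ℕ} {f : ℕ → ℝ} (h : HasDecay l f)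
    (hl : IsLength l) (n : ℕ) : 0 ≤ f n := by
  have h1 := h n (MonoidAlgebra.single 1 1) (by
    intro x hx
    have : x = 1 := by simpa using Finsupp.support_single_subset hx
    rw [this, hl.map_one]
    exact Nat.zero_le n)
  have h2 : twoNorm (MonoidAlgebra.single (1 : K) (1 : ℂ)) = 1 := by
    rw [twoNorm, MonoidAlgebra.coeff_single, Finsupp.support_single _ one_ne_zero]
    simp
  rw [h2, mul_one] at h1
  exact (norm_nonneg _).trans h1

variable {G H : Type u} {A : Type v} [Group G] [Group H] [Group A] {i : A →* G} {j : A →* H}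
  {LG : G → ℕ} {LH : H → ℕ}

/-- The lengths of the factors may be enlarged to make them positive off the common subgroup. -/
theorem HasDecay.norm_regularRep_amalgam_le (hi : Function.Injective i)
    (hj : Function.Injective j) {LG' : G → ℕ} {LH' : H → ℕ} (hLG' : IsLength LG')
    (hLH' : IsLength LH') (hpos : PositiveOffAmalgam i j LG' LH') (hG : ∀ x, LG x ≤ LG' x)
    (hH : ∀ y, LH y ≤ LH' y) {fG fH : ℕ → ℝ} (hfG : HasDecay LG fG) (hfH : HasDecay LH fH)
    {n R : ℕ} (hRG : ∀ x, universalLengthLeft i j LG LH x ≤ 2 * n → LG x ≤ R)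
    (hRH : ∀ y, universalLengthRight i j LG LH y ≤ 2 * n → LH y ≤ R) {C : ℝ} (hC : 0 ≤ C)
    (hCG : fG R ≤ C) (hCH : fH R ≤ C) (φ : MonoidAlgebra ℂ (Amalgam i j))
    (hφ : ∀ k ∈ φ.coeff.support, universalLength i j LG' LH' k ≤ n) :
    ‖regularRep φ‖ ≤ (2 * n + 1) ^ 2 * C * twoNorm φ := by
  refine GroupDecay.norm_regularRep_amalgam_le hi hj hLG' hLH' hpos hC ?_ ?_ φ hφ
  · intro φ hφ
    -- The universal length of the enlarged lengths dominates the original one, so the radius bound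
    -- for the original lengths still applies.
    refine (hfG R φ fun x hx => hRG x ((universalLength_mono hG hH _).trans (hφ x hx))).trans ?_
    exact mul_le_mul_of_nonneg_right hCG (Real.sqrt_nonneg _)
  · intro φ hφ
    refine (hfH R φ fun x hx => hRH x ((universalLength_mono hG hH _).trans (hφ x hx))).trans ?_
    exact mul_le_mul_of_nonneg_right hCH (Real.sqrt_nonneg _)

-- If `x * y` is outside `N`, then so is `x` or `y`; hence the added indicator is subadditive.
open Classical in
theorem IsLength.add_indicator {K : Type*} [Group K] {l : K → ℕ} (hl : IsLength l)
    (N : Subgroup K) : IsLength fun x => l x + if x ∈ N then 0 else 1 where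
  map_one := by simp [hl.map_one, N.one_mem]
  map_inv x := by simp [hl.map_inv]
  map_mul_le x y := by
    have h1 := hl.map_mul_le x y
    have h2 : x ∈ N → y ∈ N → x * y ∈ N := N.mul_mem
    by_cases hx : x ∈ N <;> by_cases hy : y ∈ N <;> by_cases hxy : x * y ∈ N <;>
      simp_all <;> omega

/-- Decay of the factors and control of the distortion give decay of the amalgamated free
product. -/
theorem HasDecay.amalgam (hi : Function.Injective i) (hj : Function.Injective j)
    (hLG : IsLength LG) (hLH : IsLength LH) {fG fH : ℕ → ℝ} (hfG : HasDecay LG fG)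
    (hfH : HasDecay LH fH) {R : ℕ → ℕ}
    (hRG : ∀ n x, universalLengthLeft i j LG LH x ≤ 2 * n → LG x ≤ R n)
    (hRH : ∀ n y, universalLengthRight i j LG LH y ≤ 2 * n → LH y ≤ R n) {F : ℕ → ℝ}
    (hF : ∀ n : ℕ, (2 * (n : ℝ) + 1) ^ 2 * (fG (R n) + fH (R n)) ≤ F n) :
    (∃ l : Amalgam i j → ℕ, IsLength l ∧ HasDecay l F) ∧
      (PositiveOffAmalgam i j LG LH → HasDecay (universalLength i j LG LH) F) := by
  classical
  have main : ∀ {LG' : G → ℕ} {LH' : H → ℕ}, IsLength LG' → IsLength LH' →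
      PositiveOffAmalgam i j LG' LH' → (∀ x, LG x ≤ LG' x) → (∀ y, LH y ≤ LH' y) →
      HasDecay (universalLength i j LG' LH') F := by
    intro LG' LH' hLG' hLH' hpos hG hH n φ hφ
    have h0 := hfG.nonneg hLG (R n)
    have h0' := hfH.nonneg hLH (R n)
    refine (HasDecay.norm_regularRep_amalgam_le hi hj hLG' hLH' hpos hG hH hfG hfH (hRG n) (hRH n)
      (C := fG (R n) + fH (R n)) (by positivity) (by linarith) (by linarith) φ hφ).trans ?_
    exact mul_le_mul_of_nonneg_right (hF n) (Real.sqrt_nonneg _)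
  refine ⟨⟨_, isLength_universalLength (hLG.add_indicator i.range) (hLH.add_indicator j.range),
    main (hLG.add_indicator i.range) (hLH.add_indicator j.range) ?_ ?_ ?_⟩, fun hpos =>
    main hLG hLH hpos (fun _ => le_rfl) (fun _ => le_rfl)⟩
  · exact ⟨fun x hx => by simp [hx], fun y hy => by simp [hy]⟩
  · exact fun x => Nat.le_add_right _ _
  · exact fun y => Nat.le_add_right _ _

/-- Counting distances gives the exponent `2`, which is better than the `7 / 2` in `tilde`. -/
theorem sq_le_rpow_seven_halves {x y : ℝ} (hx : 1 ≤ x) (hxy : x ≤ y) :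
    x ^ 2 ≤ y ^ (7 / 2 : ℝ) := by
  calc x ^ 2 ≤ y ^ 2 := by gcongr
    _ = y ^ (2 : ℝ) := by norm_cast
    _ ≤ _ := Real.rpow_le_rpow_of_exponent_le (hx.trans hxy) (by norm_num)

end Decay

/-! ### Explicit decay under distortion, and the RD and SD cases. -/

section MainParts

variable {G H : Type u} {A : Type v} [Group G] [Group H] [Group A] {i : A →* G} {j : A →* H}
  {LG : G → ℕ} {LH : H → ℕ}

theorem hasDecay_amalgam_of_distorted (hi : Function.Injective i) (hj : Function.Injective j)
    (hLG : IsLength LG) (hLH : IsLength LH) (hpos : PositiveOffAmalgam i j LG LH) {f : ℕ → ℝ}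
    {g : ℕ → ℕ} (hg : Monotone g) (hfG : HasDecay LG f) (hfH : HasDecay LH f)
    (hG : Distorted (fun n => (g n : ℝ)) (universalLengthLeft i j LG LH) LG)
    (hH : Distorted (fun n => (g n : ℝ)) (universalLengthRight i j LG LH) LH) :
    HasDecay (universalLength i j LG LH) (tilde (f ∘ g)) ∧
    ((∀ n, n ≤ g n) →
      HasDecay (fun k => 2 * universalLength i j LG LH k) (tilde f ∘ g)) ∧
    ((∀ n, n ≤ g n) → (∀ n, g (2 * n) ≤ 2 * g n) →
      HasDecay (universalLength i j LG LH) (tilde f ∘ g)) := by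
  -- The three conclusions differ only in the radius `R` at which `f` is evaluated and in the base
  -- `s`. Since `f` need not be monotone, `R` must be the exact argument wanted.
  have core : ∀ {n R : ℕ} {s : ℝ}, g (2 * n) ≤ R → 2 * (n : ℝ) + 1 ≤ s →
      ∀ φ : MonoidAlgebra ℂ (Amalgam i j),
      (∀ k ∈ φ.coeff.support, universalLength i j LG LH k ≤ n) →
        ‖regularRep φ‖ ≤ s ^ (7 / 2 : ℝ) * f R * twoNorm φ := by
    intro n R s hR hs φ hφ
    have h0 := hfG.nonneg hLG R
    refine (HasDecay.norm_regularRep_amalgam_le hi hj hLG hLH hpos (fun _ => le_rfl)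
      (fun _ => le_rfl) hfG hfH (n := n) (R := R) ?_ ?_ h0 le_rfl le_rfl φ hφ).trans ?_
    · intro x hx
      have h1 : LG x ≤ g (universalLengthLeft i j LG LH x) := Nat.cast_le.1 (hG x).2
      exact h1.trans ((hg hx).trans hR)
    · intro y hy
      have h1 : LH y ≤ g (universalLengthRight i j LG LH y) := Nat.cast_le.1 (hH y).2
      exact h1.trans ((hg hy).trans hR)
    · have h1 : 1 ≤ 2 * (n : ℝ) + 1 := by linarith [n.cast_nonneg (α := ℝ)]
      refine mul_le_mul_of_nonneg_right ?_ (Real.sqrt_nonneg _)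
      exact mul_le_mul_of_nonneg_right (sq_le_rpow_seven_halves h1 hs) h0
  refine ⟨fun n φ hφ => core le_rfl le_rfl φ hφ, fun hgn n φ hφ => ?_,
    fun hgn hg2 n φ hφ => ?_⟩
  -- The ball of radius `n` for `2 L^U` is the ball of radius `⌊n / 2⌋` for `L^U`, so `g` is needed
  -- only at `2 * (n / 2) ≤ n`.
  · refine core (n := n / 2) (R := 2 * g n) ?_ ?_ φ fun k hk => ?_
    · have : g (2 * (n / 2)) ≤ g n := hg (by omega)
      omega
    · have h1 : n / 2 ≤ g n := (Nat.div_le_self n 2).trans (hgn n)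
      have h2 : ((n / 2 : ℕ) : ℝ) ≤ g n := by exact_mod_cast h1
      linarith
    · have := hφ k hk
      simp only at this
      omega
  · refine core (n := n) (R := 2 * g n) (hg2 n) ?_ φ hφ
    have h2 : (n : ℝ) ≤ g n := by exact_mod_cast hgn n
    linarith

theorem hasRD_amalgam (hi : Function.Injective i) (hj : Function.Injective j)
    (hLG : IsLength LG) (hLH : IsLength LH) (hfG : HasRDWith LG) (hfH : HasRDWith LH)
    (hG : PolynomiallyDistorted (universalLengthLeft i j LG LH) LG)
    (hH : PolynomiallyDistorted (universalLengthRight i j LG LH) LH) :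
    HasRD (Amalgam i j) ∧
      (PositiveOffAmalgam i j LG LH → HasRDWith (universalLength i j LG LH)) := by
  obtain ⟨P, hP⟩ := hfG
  obtain ⟨Q, hQ⟩ := hfH
  obtain ⟨D, hD⟩ := hG
  obtain ⟨E, hE⟩ := hH
  obtain ⟨c, k, hck⟩ := exists_polynomial_bound₂ P Q
  obtain ⟨d, m, hdm⟩ := exists_polynomial_bound₂ D E
  have bound : ∀ {a b n : ℕ}, (b : ℝ) ≤ d * ((a : ℝ) + 1) ^ m → a ≤ 2 * n →
      b ≤ d * (2 * n + 1) ^ m := by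
    intro a b n hb ha
    have hb' : b ≤ d * (a + 1) ^ m := by exact_mod_cast hb
    refine hb'.trans ?_
    gcongr
  let F : Polynomial ℝ := (2 * Polynomial.X + 1) ^ 2 *
    (2 * ((c : Polynomial ℝ) * ((d : Polynomial ℝ) * (2 * Polynomial.X + 1) ^ m + 1) ^ k))
  have h := HasDecay.amalgam hi hj hLG hLH hP hQ (R := fun n => d * (2 * n + 1) ^ m)
    (F := fun n => F.eval (n : ℝ))
    (fun n x hx => bound ((hD x).2.trans (hdm _).1) hx)
    (fun n y hy => bound ((hE y).2.trans (hdm _).2) hy) (by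
      intro n
      simp only [F, Polynomial.eval_mul, Polynomial.eval_pow, Polynomial.eval_add,
        Polynomial.eval_ofNat, Polynomial.eval_X, Polynomial.eval_one, Polynomial.eval_natCast]
      have h1 := hck (d * (2 * n + 1) ^ m)
      refine mul_le_mul_of_nonneg_left ?_ (by positivity)
      push_cast at h1 ⊢
      linarith [h1.1, h1.2])
  obtain ⟨⟨l, hl, hdec⟩, h2⟩ := h
  exact ⟨⟨l, hl, F, hdec⟩, fun hpos => ⟨F, h2 hpos⟩⟩

theorem hasSD_amalgam_of_hasRDWith (hi : Function.Injective i) (hj : Function.Injective j)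
    (hLG : IsLength LG) (hLH : IsLength LH) (hfG : HasRDWith LG) (hfH : HasRDWith LH)
    (hG : SubexponentiallyDistorted (universalLengthLeft i j LG LH) LG)
    (hH : SubexponentiallyDistorted (universalLengthRight i j LG LH) LH) :
    HasSD (Amalgam i j) ∧
      (PositiveOffAmalgam i j LG LH → HasSDWith (universalLength i j LG LH)) := by
  obtain ⟨P, hP⟩ := hfG
  obtain ⟨Q, hQ⟩ := hfH
  obtain ⟨D, hDs, hD⟩ := hG
  obtain ⟨E, hEs, hE⟩ := hH
  obtain ⟨c, k, hck⟩ := exists_polynomial_bound₂ P Q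
  -- `D` and `E` need not be monotone, so their values on all of `[0, 2n]` are dominated by a
  -- partial sum.
  let S : ℕ → ℝ := fun n => ∑ m ∈ Finset.range (n + 1), (D m + E m)
  have hDE : ∀ m, 0 ≤ D m + E m := fun m => add_nonneg (hDs.1 m) (hEs.1 m)
  have hS0 : ∀ n, 0 ≤ S n := fun n => Finset.sum_nonneg fun m _ => hDE m
  have hS : SubexpBound S := (hDs.subexpBound.add hEs.subexpBound).sum_range
  have le_S : ∀ {a n : ℕ}, a ≤ 2 * n → D a + E a ≤ S (2 * n) := fun {a n} ha =>
    Finset.single_le_sum (f := fun m => D m + E m) (fun m _ => hDE m)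
      (Finset.mem_range.2 (Nat.lt_succ_of_le ha))
  -- The final `+ 1` provides the lower bound required by `SubexpBound.subexponential`.
  let F : ℕ → ℝ := fun n => (2 * (n : ℝ) + 1) ^ 2 * (2 * (c * (S (2 * n) + 1) ^ k)) + 1
  have hF : Subexponential F := by
    refine SubexpBound.subexponential ?_ fun n => ?_
    · refine SubexpBound.add (SubexpBound.mul ?_ ?_ ?_) (subexpBound_const 1)
      · refine SubexpBound.pow ?_ (fun n => by positivity) 2
        simpa using subexpBound_add_one.comp_affine 2 0
      · refine (subexpBound_const 2).mul ((subexpBound_const c).mul (SubexpBound.pow ?_ ?_ k) ?_) ?_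
        · exact SubexpBound.add (by simpa using hS.comp_affine 2 0) (subexpBound_const 1)
        all_goals
          intro n
          have := hS0 (2 * n)
          positivity
      · intro n
        have := hS0 (2 * n)
        positivity
    · have := hS0 (2 * n)
      have : 0 ≤ (2 * (n : ℝ) + 1) ^ 2 * (2 * (c * (S (2 * n) + 1) ^ k)) := by positivity
      simp only [F]
      linarith
  have h := HasDecay.amalgam hi hj hLG hLH hP hQ (R := fun n => ⌊S (2 * n)⌋₊) (F := F)
    (fun n x hx => Nat.le_floor (by
      linarith [(hD x).2, hEs.1 (universalLengthLeft i j LG LH x), le_S hx]))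
    (fun n y hy => Nat.le_floor (by
      linarith [(hE y).2, hDs.1 (universalLengthRight i j LG LH y), le_S hy])) (by
      intro n
      have h1 := hck ⌊S (2 * n)⌋₊
      have h2 : (c : ℝ) * ((⌊S (2 * n)⌋₊ : ℝ) + 1) ^ k ≤ c * (S (2 * n) + 1) ^ k := by
        gcongr
        exact Nat.floor_le (hS0 _)
      refine le_trans (mul_le_mul_of_nonneg_left ?_ (by positivity)) (le_add_of_nonneg_right
        zero_le_one)
      linarith [h1.1, h1.2])
  obtain ⟨⟨l, hl, hdec⟩, h2⟩ := h
  exact ⟨⟨l, hl, F, hF, hdec⟩, fun hpos => ⟨F, hF, h2 hpos⟩⟩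

theorem hasSD_amalgam_of_linearlyDistorted (hi : Function.Injective i)
    (hj : Function.Injective j) (hLG : IsLength LG) (hLH : IsLength LH) (hfG : HasSDWith LG)
    (hfH : HasSDWith LH) (hG : LinearlyDistorted (universalLengthLeft i j LG LH) LG)
    (hH : LinearlyDistorted (universalLengthRight i j LG LH) LH) :
    HasSD (Amalgam i j) ∧
      (PositiveOffAmalgam i j LG LH → HasSDWith (universalLength i j LG LH)) := by
  obtain ⟨p, hps, hp⟩ := hfG
  obtain ⟨q, hqs, hq⟩ := hfH
  obtain ⟨C, D, hCD⟩ := hG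
  obtain ⟨C', D', hCD'⟩ := hH
  -- Chosen so that `C * a + D` and `C' * a + D'` are at most `c * n + c` whenever `a ≤ 2 * n`,
  -- whatever the signs.
  let c : ℕ := ⌈2 * (|C| + |C'|) + (|D| + |D'|)⌉₊
  have hc : 2 * (|C| + |C'|) + (|D| + |D'|) ≤ c := Nat.le_ceil _
  have bound : ∀ {a b n : ℕ} {x y : ℝ}, |x| ≤ |C| + |C'| → |y| ≤ |D| + |D'| →
      (b : ℝ) ≤ x * a + y → a ≤ 2 * n → b ≤ c * n + c := by
    intro a b n x y hx hy hb ha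
    have ha' : (a : ℝ) ≤ 2 * n := by exact_mod_cast ha
    have hn : (0 : ℝ) ≤ n := n.cast_nonneg
    have h1 : x * a ≤ (|C| + |C'|) * (2 * n) :=
      mul_le_mul ((le_abs_self x).trans hx) ha' a.cast_nonneg (by positivity)
    have h2 : 2 * (|C| + |C'|) * n ≤ c * n := by
      gcongr
      linarith [abs_nonneg D, abs_nonneg D']
    have h3 : (b : ℝ) ≤ c * n + c := by
      linarith [le_abs_self y, abs_nonneg C, abs_nonneg C']
    exact_mod_cast h3
  -- Linear distortion makes the radius affine in `n`, and composition with an affine map preserves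
  -- subexponential bounds even for non-monotone `p` and `q`.
  let F : ℕ → ℝ := fun n => (2 * (n : ℝ) + 1) ^ 2 * (p (c * n + c) + q (c * n + c)) + 1
  have h0 : ∀ n, 0 ≤ p n + q n := fun n => add_nonneg (hps.1 n) (hqs.1 n)
  have hF : Subexponential F := by
    refine SubexpBound.subexponential ?_ fun n => ?_
    · refine SubexpBound.add (SubexpBound.mul ?_ ?_ fun n => h0 _) (subexpBound_const 1)
      · refine SubexpBound.pow ?_ (fun n => by positivity) 2
        simpa using subexpBound_add_one.comp_affine 2 0
      · exact (hps.subexpBound.comp_affine c c).add (hqs.subexpBound.comp_affine c c)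
    · have := h0 (c * n + c)
      have : 0 ≤ (2 * (n : ℝ) + 1) ^ 2 * (p (c * n + c) + q (c * n + c)) := by positivity
      simp only [F]
      linarith
  have h := HasDecay.amalgam hi hj hLG hLH hp hq (R := fun n => c * n + c) (F := F)
    (fun n x hx => bound (by linarith [abs_nonneg C']) (by linarith [abs_nonneg D'])
      (hCD x).2 hx)
    (fun n y hy => bound (by linarith [abs_nonneg C]) (by linarith [abs_nonneg D])
      (hCD' y).2 hy)
    (fun n => le_add_of_nonneg_right zero_le_one)
  obtain ⟨⟨l, hl, hdec⟩, h2⟩ := h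
  exact ⟨⟨l, hl, F, hF, hdec⟩, fun hpos => ⟨F, hF, h2 hpos⟩⟩

end MainParts

end GroupDecay

theorem mainTheorem2 {G H : Type u} {A : Type v} [Group G] [Group H] [Group A]
    (i : A →* G) (j : A →* H) (hi : Function.Injective i) (hj : Function.Injective j)
    (LG : G → ℕ) (LH : H → ℕ) (hLG : IsLength LG) (hLH : IsLength LH) :
    IsLength (universalLength i j LG LH) ∧
    (PositiveOffAmalgam i j LG LH →
      ∀ (f : ℕ → ℝ) (g : ℕ → ℕ), Monotone g → HasDecay LG f → HasDecay LH f →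
      Distorted (fun n => (g n : ℝ)) (universalLengthLeft i j LG LH) LG →
      Distorted (fun n => (g n : ℝ)) (universalLengthRight i j LG LH) LH →
        HasDecay (universalLength i j LG LH) (tilde (f ∘ g)) ∧
        ((∀ n, n ≤ g n) →
          HasDecay (fun k => 2 * universalLength i j LG LH k) (tilde f ∘ g)) ∧
        ((∀ n, n ≤ g n) → (∀ n, g (2 * n) ≤ 2 * g n) →
          HasDecay (universalLength i j LG LH) (tilde f ∘ g))) ∧
    (HasRDWith LG → HasRDWith LH →
      PolynomiallyDistorted (universalLengthLeft i j LG LH) LG →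
      PolynomiallyDistorted (universalLengthRight i j LG LH) LH →
        HasRD (Amalgam i j) ∧
        (PositiveOffAmalgam i j LG LH → HasRDWith (universalLength i j LG LH))) ∧
    (HasRDWith LG → HasRDWith LH →
      SubexponentiallyDistorted (universalLengthLeft i j LG LH) LG →
      SubexponentiallyDistorted (universalLengthRight i j LG LH) LH →
        HasSD (Amalgam i j) ∧
        (PositiveOffAmalgam i j LG LH → HasSDWith (universalLength i j LG LH))) ∧
    (HasSDWith LG → HasSDWith LH →
      LinearlyDistorted (universalLengthLeft i j LG LH) LG →
      LinearlyDistorted (universalLengthRight i j LG LH) LH →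
        HasSD (Amalgam i j) ∧
        (PositiveOffAmalgam i j LG LH → HasSDWith (universalLength i j LG LH))) := by
  exact ⟨isLength_universalLength hLG hLH,
    fun hpos _ _ hg hfG hfH hG hH =>
      hasDecay_amalgam_of_distorted hi hj hLG hLH hpos hg hfG hfH hG hH,
    fun hfG hfH hG hH => hasRD_amalgam hi hj hLG hLH hfG hfH hG hH,
    fun hfG hfH hG hH => hasSD_amalgam_of_hasRDWith hi hj hLG hLH hfG hfH hG hH,
    fun hfG hfH hG hH => hasSD_amalgam_of_linearlyDistorted hi hj hLG hLH hfG hfH hG hH⟩
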